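/- Let $k$ be a field and $Q$ a quiver with finitely many vertices and arrows. Let $kQ$ be its path algebra (basis: all paths, including the trivial paths $e_v$; product: concatenation, or $0$ if the paths are not composable), graded by path length. Let $\mathrm{Gr}\,kQ$ be the category of $\mathbb Z$-graded right $kQ$-modules with degree-preserving homomorphisms, let $\mathrm{Tors}\,kQ$ be the Serre subcategory of those $M$ in which every $m\in M$ satisfies $m\,(kQ)_{\ge n}=0$ for some $n$, and let $\pi^*:\mathrm{Gr}\,kQ\to \mathrm{QGr}\,kQ=\mathrm{Gr}\,kQ/\mathrm{Tors}\,kQ$ be the quotient functor. A vertex is called cyclic if it lies on a cycle, that is, on a closed path of positive length with pairwise distinct arrows. For a cyclic vertex $v$ let $\mathcal O_v$ be the quotient of $e_v kQ$ by the right submodule generated by all paths that start at $v$ and end at a vertex not on a simple cycle through $v$ (a simple cycle being a closed path $(v_0,\dots,v_m=v_0)$, $m\ge 1$, with $v_1,\dots,v_m$ pairwise distinct). Suppose that $kQ$ has Gelfand–Kirillov dimension one, i.e. $\sup_W\limsup_{n\to\infty}\log\dim_k(k+W+\cdots+W^n)/\log n=1$, where $W$ runs over the finite-dimensional subspaces of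 $kQ$. Let $n$ be the number of cyclic vertices of $Q$. Then: 1. there is an equivalence of categories $\mathrm{QGr}\,kQ\simeq \mathrm{Mod}\,k^n$; 2. $\mathrm{QGr}\,kQ$ is semisimple: every object is a coproduct of simple objects; 3. for every cyclic vertex $v$ the object $\pi^*\mathcal O_v$ of $\mathrm{QGr}\,kQ$ is simple and projective, and every simple object of $\mathrm{QGr}\,kQ$ is isomorphic to $\pi^*\mathcal O_v$ for exactly one cyclic vertex $v$. -/

import Mathlib

open CategoryTheory CategoryTheory.Limits MulOpposite

universe u w

noncomputable section

/-! ### Gelfand–Kirillov dimension -/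

/-- `1 + V + V² + ⋯ + Vⁿ` for a subspace `V` of a `k`-algebra. -/
def powersUpTo {k A : Type*} [Field k] [Ring A] [Algebra k A] (V : Submodule k A) (n : ℕ) :
    Submodule k A :=
  ⨆ i : Fin (n + 1), V ^ (i : ℕ)

/-- The Gelfand–Kirillov dimension
`sup_V limsup_n log dim(1 + V + ⋯ + Vⁿ) / log n`,
the supremum being over all finite-dimensional subspaces `V` of `A`. -/
def GKdim (k A : Type*) [Field k] [Ring A] [Algebra k A] : EReal :=
  ⨆ (V : Submodule k A) (_ : V.FG),
    Filter.limsup (fun n : ℕ =>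
      ((Real.log (Module.finrank k (powersUpTo V n)) / Real.log n : ℝ) : EReal)) Filter.atTop

/-! ### Graded right modules -/

theorem isInternal_of_proj {ι M σ : Type*} [DecidableEq ι] [AddCommGroup M] [SetLike σ M]
    [AddSubmonoidClass σ M] (ℳ : ι → σ) (π : ι → M →+ M)
    (h1 : ∀ i, ∀ x ∈ ℳ i, π i x = x) (h2 : ∀ i j, i ≠ j → ∀ x ∈ ℳ j, π i x = 0)
    (h3 : ∀ x, ∃ (s : Finset ι) (f : ι → M), (∀ i, f i ∈ ℳ i) ∧ x = ∑ i ∈ s, f i) :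
    DirectSum.IsInternal ℳ := by
  have key : ∀ (y : DirectSum ι fun i => ℳ i) (i : ι),
      π i (DirectSum.coeAddMonoidHom ℳ y) = y i := by
    intro y i
    induction y using DirectSum.induction_on with
    | zero => simp
    | of j x =>
      rw [DirectSum.coeAddMonoidHom_of]
      by_cases h : i = j
      · subst h; rw [h1 _ _ x.2, DirectSum.of_eq_same]
      · rw [h2 _ _ h _ x.2, DirectSum.of_eq_of_ne _ _ _ h]; rfl
    | add a b ha hb => rw [map_add, map_add, ha, hb]; rfl
  refine ⟨fun y z h => ?_, fun x => ?_⟩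
  · apply DFinsupp.ext
    intro i
    apply Subtype.ext
    exact (key y i).symm.trans ((congrArg (π i) h).trans (key z i))
  · obtain ⟨s, f, hf, rfl⟩ := h3 x
    refine ⟨∑ i ∈ s, DirectSum.of (fun i => ℳ i) i ⟨f i, hf i⟩, ?_⟩
    rw [map_sum]
    exact Finset.sum_congr rfl fun i _ => DirectSum.coeAddMonoidHom_of _ _ _

section Graded

variable {k A : Type*} [Field k] [Ring A] [Algebra k A]

/-- A `ℤ`-graded right module over the algebra `A = ⨁ 𝒜 n`; right modules over `A`
are modules over the opposite ring, with `op a • m` standing for `m a`. -/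
structure GrMod (𝒜 : ℕ → Submodule k A) where
  carrier : Type w
  [addCommGroup : AddCommGroup carrier]
  [module : Module Aᵐᵒᵖ carrier]
  deg : ℤ → AddSubgroup carrier
  isInternal : DirectSum.IsInternal deg
  smul_mem : ∀ (n : ℕ) (i : ℤ), ∀ a ∈ 𝒜 n, ∀ m ∈ deg i, op a • m ∈ deg (i + n)

namespace GrMod

variable {𝒜 : ℕ → Submodule k A}

instance : CoeSort (GrMod.{w} 𝒜) (Type w) := ⟨GrMod.carrier⟩

attribute [instance] GrMod.addCommGroup GrMod.module

/-- A degree-preserving homomorphism of right modules. -/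
@[ext]
structure Hom (M N : GrMod.{w} 𝒜) where
  lin : M →ₗ[Aᵐᵒᵖ] N
  map_mem : ∀ i, ∀ m ∈ M.deg i, lin m ∈ N.deg i

instance : Category (GrMod.{w} 𝒜) where
  Hom M N := Hom M N
  id M := ⟨LinearMap.id, fun _ _ h => h⟩
  comp f g := ⟨g.lin ∘ₗ f.lin, fun i m h => g.map_mem i _ (f.map_mem i m h)⟩

variable {M N K : GrMod.{w} 𝒜}

theorem hom_ext {f g : M ⟶ N} (h : ∀ m, f.lin m = g.lin m) : f = g :=
  Hom.ext (LinearMap.ext h)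

@[simp] theorem id_lin (m : M) : Hom.lin (𝟙 M) m = m := rfl

@[simp] theorem comp_lin (f : M ⟶ N) (g : N ⟶ K) (m : M) : (f ≫ g).lin m = g.lin (f.lin m) := rfl

instance : Zero (M ⟶ N) := ⟨⟨0, fun i _ _ => (N.deg i).zero_mem⟩⟩
instance : Add (M ⟶ N) :=
  ⟨fun f g => ⟨f.lin + g.lin, fun i m h => (N.deg i).add_mem (f.map_mem i m h) (g.map_mem i m h)⟩⟩
instance : Neg (M ⟶ N) :=
  ⟨fun f => ⟨-f.lin, fun i m h => (N.deg i).neg_mem (f.map_mem i m h)⟩⟩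
instance : Sub (M ⟶ N) :=
  ⟨fun f g => ⟨f.lin - g.lin, fun i m h => (N.deg i).sub_mem (f.map_mem i m h) (g.map_mem i m h)⟩⟩
instance : SMul ℕ (M ⟶ N) :=
  ⟨fun c f => ⟨c • f.lin, fun i m h => (N.deg i).nsmul_mem (f.map_mem i m h) c⟩⟩
instance : SMul ℤ (M ⟶ N) :=
  ⟨fun c f => ⟨c • f.lin, fun i m h => (N.deg i).zsmul_mem (f.map_mem i m h) c⟩⟩

instance : AddCommGroup (M ⟶ N) :=
  Function.Injective.addCommGroup (fun f : M ⟶ N => f.lin) (fun _ _ h => Hom.ext h)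
    rfl (fun _ _ => rfl) (fun _ => rfl) (fun _ _ => rfl) (fun _ _ => rfl) (fun _ _ => rfl)

@[simp] theorem zero_lin (m : M) : (0 : M ⟶ N).lin m = 0 := rfl
@[simp] theorem add_lin (f g : M ⟶ N) (m : M) : (f + g).lin m = f.lin m + g.lin m := rfl

instance : Preadditive (GrMod.{w} 𝒜) where
  add_comp _ _ _ f f' g := hom_ext fun m => by simp
  comp_add _ _ _ f g g' := hom_ext fun m => by simp

/-! ### Homogeneous components -/

/-- The homogeneous component of degree `i`. -/
def proj (M : GrMod.{w} 𝒜) (i : ℤ) : M →+ M :=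
  letI := M.isInternal.chooseDecomposition
  { toFun := fun m => (DirectSum.decompose M.deg m i : M)
    map_zero' := by simp
    map_add' := fun x y => by simp [DirectSum.decompose_add] }

theorem proj_mem (i : ℤ) (m : M) : M.proj i m ∈ M.deg i := by
  let := M.isInternal.chooseDecomposition
  exact (DirectSum.decompose M.deg m i).2

theorem proj_same {i : ℤ} {m : M} (h : m ∈ M.deg i) : M.proj i m = m := by
  let := M.isInternal.chooseDecomposition
  exact DirectSum.decompose_of_mem_same M.deg h

theorem proj_ne {i j : ℤ} (hij : i ≠ j) {m : M} (h : m ∈ M.deg j) : M.proj i m = 0 := by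
  let := M.isInternal.chooseDecomposition
  exact DirectSum.decompose_of_mem_ne M.deg h hij.symm

theorem exists_sum_proj (M : GrMod.{w} 𝒜) (m : M) :
    ∃ s : Finset ℤ, m = ∑ i ∈ s, M.proj i m := by
  classical
  let := M.isInternal.chooseDecomposition
  exact ⟨_, (DirectSum.sum_support_decompose M.deg m).symm⟩

theorem hom_proj (f : M ⟶ N) (i : ℤ) (m : M) : f.lin (M.proj i m) = N.proj i (f.lin m) := by
  obtain ⟨s, hs⟩ := M.exists_sum_proj m
  conv_rhs => rw [hs]
  conv_lhs => rw [hs]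
  simp only [map_sum]
  refine Finset.sum_congr rfl fun j _ => ?_
  by_cases h : i = j
  · subst h
    rw [proj_same (proj_mem i m), proj_same (f.map_mem i _ (proj_mem i m))]
  · rw [proj_ne h (proj_mem j m), proj_ne h (f.map_mem j _ (proj_mem j m)), map_zero]

theorem proj_smul {n : ℕ} {a : A} (ha : a ∈ 𝒜 n) (i : ℤ) (m : M) :
    M.proj i (op a • m) = op a • M.proj (i - n) m := by
  obtain ⟨s, hs⟩ := M.exists_sum_proj m
  conv_rhs => rw [hs]
  conv_lhs => rw [hs]
  simp only [map_sum, Finset.smul_sum]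
  refine Finset.sum_congr rfl fun j _ => ?_
  have hj := M.smul_mem n j a ha _ (proj_mem j m)
  by_cases h : i = j + n
  · subst h
    rw [proj_same hj, add_sub_cancel_right, proj_same (proj_mem j m)]
  · rw [proj_ne h hj, proj_ne (fun h' => h (by omega)) (proj_mem j m), smul_zero]

/-- A graded submodule: it contains the homogeneous components of its elements. -/
def IsHomog (M : GrMod.{w} 𝒜) (S : Submodule Aᵐᵒᵖ M) : Prop :=
  ∀ i, ∀ m ∈ S, M.proj i m ∈ S

/-- A right submodule generated by homogeneous elements is graded. -/
theorem isHomog_span [GradedRing 𝒜] (M : GrMod.{w} 𝒜) (X : Set M)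
    (hX : ∀ x ∈ X, ∃ i, x ∈ M.deg i) : M.IsHomog (Submodule.span Aᵐᵒᵖ X) := by
  intro i m hm
  revert i
  induction hm using Submodule.span_induction with
  | mem x hx =>
    intro i
    obtain ⟨j, hj⟩ := hX x hx
    by_cases h : i = j
    · subst h; rw [proj_same hj]; exact Submodule.subset_span hx
    · rw [proj_ne h hj]; exact Submodule.zero_mem _
  | zero => intro i; simp
  | add x y _ _ hx hy => intro i; rw [map_add]; exact Submodule.add_mem _ (hx i) (hy i)
  | smul a x _ hx =>
    obtain ⟨a, rfl⟩ := op_surjective a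
    induction a using DirectSum.Decomposition.inductionOn 𝒜 with
    | zero => intro i; simp
    | homogeneous a => intro i; rw [proj_smul a.2]; exact Submodule.smul_mem _ _ (hx _)
    | add a b ha hb =>
      intro i
      rw [MulOpposite.op_add, add_smul, map_add]
      exact Submodule.add_mem _ (ha i) (hb i)

/-- A graded submodule as a graded module. -/
def sub (M : GrMod.{w} 𝒜) (S : Submodule Aᵐᵒᵖ M) (hS : M.IsHomog S) : GrMod.{w} 𝒜 where
  carrier := S
  deg i := (M.deg i).comap S.subtype.toAddMonoidHom
  isInternal := isInternal_of_proj _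
    (fun i => ((M.proj i).comp S.subtype.toAddMonoidHom).codRestrict S fun x => hS i _ x.2)
    (fun _ _ hx => Subtype.ext (proj_same hx))
    (fun _ _ h _ hx => Subtype.ext (proj_ne h hx))
    (fun x => by
      obtain ⟨s, hs⟩ := M.exists_sum_proj x.1
      refine ⟨s, fun i => ⟨M.proj i x.1, hS i _ x.2⟩, fun i => proj_mem i x.1, ?_⟩
      apply Subtype.ext
      rw [AddSubmonoidClass.coe_finsetSum]
      exact hs)
  smul_mem n i a ha m hm := M.smul_mem n i a ha _ hm

/-- The quotient of a graded module by a graded submodule. -/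
def quot (M : GrMod.{w} 𝒜) (S : Submodule Aᵐᵒᵖ M) (hS : M.IsHomog S) : GrMod.{w} 𝒜 where
  carrier := M ⧸ S
  deg i := (M.deg i).map S.mkQ.toAddMonoidHom
  isInternal := isInternal_of_proj _
    (fun i => QuotientAddGroup.map S.toAddSubgroup S.toAddSubgroup (M.proj i)
      fun x hx => hS i x hx)
    (by
      rintro i _ ⟨x, hx, rfl⟩
      exact congrArg S.mkQ (proj_same hx))
    (by
      rintro i j h _ ⟨x, hx, rfl⟩
      exact (congrArg S.mkQ (proj_ne h hx)).trans (map_zero _))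
    (fun x => by
      obtain ⟨x, rfl⟩ := S.mkQ_surjective x
      obtain ⟨s, hs⟩ := M.exists_sum_proj x
      refine ⟨s, fun i => S.mkQ (M.proj i x), fun i => ⟨_, proj_mem i x, rfl⟩, ?_⟩
      rw [← map_sum, ← hs])
  smul_mem := by
    rintro n i a ha _ ⟨x, hx, rfl⟩
    exact ⟨_, M.smul_mem n i a ha x hx, rfl⟩

/-- The inclusion of a graded submodule. -/
def subι (M : GrMod.{w} 𝒜) (S : Submodule Aᵐᵒᵖ M) (hS : M.IsHomog S) : M.sub S hS ⟶ M :=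
  ⟨S.subtype, fun _ _ h => h⟩

/-- The projection to a quotient module. -/
def quotπ (M : GrMod.{w} 𝒜) (S : Submodule Aᵐᵒᵖ M) (hS : M.IsHomog S) : M ⟶ M.quot S hS :=
  ⟨S.mkQ, fun _ m h => ⟨m, h, rfl⟩⟩

theorem isHomog_ker (f : M ⟶ N) : M.IsHomog (LinearMap.ker f.lin) := fun i m hm => by
  rw [LinearMap.mem_ker] at hm ⊢
  rw [hom_proj, hm, map_zero]

theorem isHomog_range (f : M ⟶ N) : N.IsHomog (LinearMap.range f.lin) := by
  rintro i _ ⟨m, rfl⟩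
  exact ⟨M.proj i m, hom_proj f i m⟩

/-! ### The category of graded modules is abelian -/

instance : HasKernels (GrMod.{w} 𝒜) where
  has_limit f := ⟨_, KernelFork.IsLimit.ofι (f := f) (subι _ _ (isHomog_ker f))
    (hom_ext fun m => m.2)
    (fun {W} g hg => ⟨LinearMap.codRestrict _ g.lin fun x =>
      congrArg (fun t : W ⟶ _ => t.lin x) hg, fun i m h => g.map_mem i m h⟩)
    (fun _ _ => rfl)
    (fun _ _ _ hm => hom_ext fun x => Subtype.ext
      (congrArg (fun t => Hom.lin t x) hm))⟩

instance : HasCokernels (GrMod.{w} 𝒜) where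
  has_colimit f := ⟨_, CokernelCofork.IsColimit.ofπ (f := f) (quotπ _ _ (isHomog_range f))
    (hom_ext fun m => (Submodule.Quotient.mk_eq_zero _).2 ⟨m, rfl⟩)
    (fun {W} g hg => ⟨Submodule.liftQ _ g.lin (by
      rintro _ ⟨x, rfl⟩
      exact congrArg (fun t => Hom.lin t x) hg), by
      rintro i _ ⟨x, hx, rfl⟩
      exact g.map_mem i x hx⟩)
    (fun _ _ => rfl)
    (fun _ _ _ hm => hom_ext fun x => by
      obtain ⟨x, rfl⟩ := Submodule.mkQ_surjective _ x
      exact congrArg (fun t => Hom.lin t x) hm)⟩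

/-- The zero module. -/
def zeroObj : GrMod.{w} 𝒜 where
  carrier := PUnit
  deg _ := ⊤
  isInternal := isInternal_of_proj _ (fun _ => 0) (fun _ _ _ => rfl) (fun _ _ _ _ _ => rfl)
    (fun _ => ⟨∅, fun _ => 0, fun _ => trivial, rfl⟩)
  smul_mem _ _ _ _ _ _ := trivial

instance : HasZeroObject (GrMod.{w} 𝒜) :=
  ⟨zeroObj, (IsZero.iff_id_eq_zero _).2 (hom_ext fun _ => rfl)⟩

/-- The direct sum of two graded modules. -/
def prod (M N : GrMod.{w} 𝒜) : GrMod.{w} 𝒜 where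
  carrier := M × N
  deg i := (M.deg i).prod (N.deg i)
  isInternal := isInternal_of_proj _ (fun i => (M.proj i).prodMap (N.proj i))
    (fun i x hx => Prod.ext (proj_same hx.1) (proj_same hx.2))
    (fun i j h x hx => Prod.ext (proj_ne h hx.1) (proj_ne h hx.2))
    (fun x => by
      have aux : ∀ (L : GrMod.{w} 𝒜) (y : L) (s t : Finset ℤ), s ⊆ t →
          y = ∑ i ∈ s, L.proj i y → y = ∑ i ∈ t, L.proj i y := by
        intro L y s t hst hs
        rw [← Finset.sum_subset hst, ← hs]
        intro j _ hj
        rw [hs, map_sum]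
        exact Finset.sum_eq_zero fun i hi =>
          proj_ne (fun h : j = i => hj (by rw [h]; exact hi)) (proj_mem i y)
      obtain ⟨s, hs⟩ := M.exists_sum_proj x.1
      obtain ⟨t, ht⟩ := N.exists_sum_proj x.2
      refine ⟨s ∪ t, fun i => (M.proj i x.1, N.proj i x.2),
        fun i => ⟨proj_mem i _, proj_mem i _⟩, ?_⟩
      refine Prod.ext ?_ ?_
      · rw [Prod.fst_sum]; exact aux M _ s _ Finset.subset_union_left hs
      · rw [Prod.snd_sum]; exact aux N _ t _ Finset.subset_union_right ht)
  smul_mem n i a ha m hm := ⟨M.smul_mem n i a ha _ hm.1, N.smul_mem n i a ha _ hm.2⟩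

instance : HasBinaryBiproducts (GrMod.{w} 𝒜) where
  has_binary_biproduct M N := HasBinaryBiproduct.mk
    { bicone :=
        { pt := M.prod N
          fst := ⟨LinearMap.fst _ _ _, fun _ _ h => h.1⟩
          snd := ⟨LinearMap.snd _ _ _, fun _ _ h => h.2⟩
          inl := ⟨LinearMap.inl _ _ _, fun i _ h => ⟨h, (N.deg i).zero_mem⟩⟩
          inr := ⟨LinearMap.inr _ _ _, fun i _ h => ⟨(M.deg i).zero_mem, h⟩⟩
          inl_fst := rfl
          inl_snd := rfl
          inr_fst := rfl
          inr_snd := rfl }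
      isBilimit := isBinaryBilimitOfTotal _ (hom_ext fun x => by
        refine Prod.ext ?_ ?_
        · exact add_zero _
        · exact zero_add _) }

instance : HasFiniteProducts (GrMod.{w} 𝒜) :=
  hasFiniteProducts_of_has_binary_and_terminal

theorem injective_of_mono (f : M ⟶ N) [Mono f] : Function.Injective f.lin := by
  rw [← LinearMap.ker_eq_bot, LinearMap.ker_eq_bot']
  intro m hm
  have h : subι _ _ (isHomog_ker f) = 0 := by
    rw [← cancel_mono f, zero_comp]
    exact hom_ext fun x => x.2
  exact congrArg (fun t : M.sub _ (isHomog_ker f) ⟶ M => t.lin ⟨m, hm⟩) h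

theorem surjective_of_epi (f : M ⟶ N) [Epi f] : Function.Surjective f.lin := by
  intro n
  have h : quotπ _ _ (isHomog_range f) = 0 := by
    rw [← cancel_epi f, comp_zero]
    exact hom_ext fun x => (Submodule.Quotient.mk_eq_zero _).2 ⟨x, rfl⟩
  exact (Submodule.Quotient.mk_eq_zero _).1
    (congrArg (fun t : N ⟶ N.quot _ (isHomog_range f) => t.lin n) h)

/-- A monomorphism is the kernel of its cokernel. -/
theorem nonempty_normalMono (f : M ⟶ N) [Mono f] : Nonempty (NormalMono f) := ⟨{
  Z := N.quot _ (isHomog_range f)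
  g := quotπ _ _ (isHomog_range f)
  w := hom_ext fun m => (Submodule.Quotient.mk_eq_zero _).2 ⟨m, rfl⟩
  isLimit :=
    let e := LinearEquiv.ofInjective f.lin (injective_of_mono f)
    have he : ∀ y, f.lin (e.symm y) = y.1 := fun y =>
      congrArg Subtype.val (e.apply_symm_apply y)
    have hr : ∀ {W : GrMod.{w} 𝒜} (g : W ⟶ N), g ≫ quotπ _ _ (isHomog_range f) = 0 →
        ∀ x, g.lin x ∈ LinearMap.range f.lin := fun {W} g hg x =>
      (Submodule.Quotient.mk_eq_zero _).1 (congrArg (fun t => Hom.lin t x) hg)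
    KernelFork.IsLimit.ofι _ _
      (fun {W} g hg => ⟨e.symm.toLinearMap ∘ₗ g.lin.codRestrict _ (hr g hg), fun i x hx => by
        have h1 : f.lin (e.symm (g.lin.codRestrict _ (hr g hg) x)) = g.lin x := he _
        have h2 : M.proj i (e.symm (g.lin.codRestrict _ (hr g hg) x)) =
            e.symm (g.lin.codRestrict _ (hr g hg) x) := by
          apply injective_of_mono f
          rw [hom_proj, h1, proj_same (g.map_mem i x hx)]
        change e.symm (g.lin.codRestrict _ (hr g hg) x) ∈ M.deg i
        rw [← h2]
        exact proj_mem i _⟩)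
      (fun g hg => hom_ext fun x => he _)
      (fun g hg m hm => (cancel_mono f).1 (hm.trans (hom_ext fun x => (he ⟨g.lin x, hr g hg x⟩).symm))) }⟩

/-- An epimorphism is the cokernel of its kernel. -/
theorem nonempty_normalEpi (f : M ⟶ N) [Epi f] : Nonempty (NormalEpi f) := ⟨{
  W := M.sub _ (isHomog_ker f)
  g := subι _ _ (isHomog_ker f)
  w := hom_ext fun m => m.2
  isColimit :=
    let e := f.lin.quotKerEquivOfSurjective (surjective_of_epi f)
    have he : ∀ m, e.symm (f.lin m) = Submodule.Quotient.mk m := fun m =>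
      (LinearEquiv.symm_apply_eq e).2 rfl
    have hk : ∀ {W : GrMod.{w} 𝒜} (g : M ⟶ W), subι _ _ (isHomog_ker f) ≫ g = 0 →
        LinearMap.ker f.lin ≤ LinearMap.ker g.lin := fun {W} g hg x hx =>
      congrArg (fun t : M.sub _ (isHomog_ker f) ⟶ W => t.lin ⟨x, hx⟩) hg
    have hd : ∀ {W : GrMod.{w} 𝒜} (g : M ⟶ W) (hg : subι _ _ (isHomog_ker f) ≫ g = 0) (m : M),
        (Submodule.liftQ _ g.lin (hk g hg) ∘ₗ e.symm.toLinearMap) (f.lin m) = g.lin m :=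
      fun {W} g hg m => by
        rw [LinearMap.comp_apply, LinearEquiv.coe_coe, he]; rfl
    CokernelCofork.IsColimit.ofπ _ _
      (fun {W} g hg => ⟨Submodule.liftQ _ g.lin (hk g hg) ∘ₗ e.symm.toLinearMap,
        fun i x hx => by
          obtain ⟨m, rfl⟩ := surjective_of_epi f x
          rw [← proj_same hx, ← hom_proj, hd g hg]
          exact g.map_mem i _ (proj_mem i m)⟩)
      (fun g hg => hom_ext fun x => hd g hg x)
      (fun g hg m hm => (cancel_epi f).1 (hm.trans (hom_ext fun x => (hd g hg x).symm))) }⟩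

instance : Abelian (GrMod.{w} 𝒜) where
  normalMonoOfMono f _ := nonempty_normalMono f
  normalEpiOfEpi f _ := nonempty_normalEpi f

/-- Torsion modules: each element `m` satisfies `m A_{≥ n} = 0` for some `n`. -/
def tors (𝒜 : ℕ → Submodule k A) : ObjectProperty (GrMod.{w} 𝒜) :=
  fun M => ∀ m : M, ∃ n : ℕ, ∀ i ≥ n, ∀ a ∈ 𝒜 i, op a • m = 0

end GrMod

end Graded

/-! ### Path algebras -/

/-- All paths of the quiver `V`, including the trivial ones. -/
abbrev AnyPath (V : Type u) [Quiver.{u} V] : Type u :=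
  Σ a b : V, Quiver.Path a b

/-- The length of a path. -/
def AnyPath.length {V : Type u} [Quiver.{u} V] (p : AnyPath V) : ℕ := p.2.2.length

/-- The path algebra: the vector space with basis the set of all paths, the product of
two basis elements being their concatenation if they are composable and zero otherwise. -/
def PathAlgebra (k : Type u) [Field k] (V : Type u) [Quiver.{u} V] : Type u :=
  AnyPath V →₀ k

namespace PathAlgebra

variable {k : Type u} [Field k] {V : Type u} [Quiver.{u} V]

instance : AddCommGroup (PathAlgebra k V) := inferInstanceAs (AddCommGroup (AnyPath V →₀ k))
instance : Module k (PathAlgebra k V) := inferInstanceAs (Module k (AnyPath V →₀ k))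

/-- The basis element given by a path. -/
def ofPath (p : AnyPath V) : PathAlgebra k V := Finsupp.single p 1

open Classical in
/-- The product of two paths: their concatenation if composable, zero otherwise. -/
def pathMul (p q : AnyPath V) : PathAlgebra k V :=
  if h : p.2.1 = q.1 then ofPath ⟨p.1, q.2.1, (p.2.2.cast rfl h).comp q.2.2⟩ else 0

theorem pathMul_comp {a b c : V} (p : Quiver.Path a b) (q : Quiver.Path b c) :
    (pathMul ⟨a, b, p⟩ ⟨b, c, q⟩ : PathAlgebra k V) = ofPath ⟨a, c, p.comp q⟩ := by
  rw [pathMul, dif_pos rfl]; rfl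

theorem pathMul_ne {p q : AnyPath V} (h : p.2.1 ≠ q.1) :
    (pathMul p q : PathAlgebra k V) = 0 := by
  rw [pathMul, dif_neg h]

/-- The bilinear extension of the product of paths. -/
def mulₗ : PathAlgebra k V →ₗ[k] PathAlgebra k V →ₗ[k] PathAlgebra k V :=
  Finsupp.linearCombination k fun p => Finsupp.linearCombination k fun q => pathMul p q

instance : Mul (PathAlgebra k V) := ⟨fun x y => mulₗ x y⟩

theorem mul_def (x y : PathAlgebra k V) : x * y = mulₗ x y := rfl

theorem ofPath_mul (p q : AnyPath V) :
    (ofPath p * ofPath q : PathAlgebra k V) = pathMul p q := by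
  have h1 : mulₗ (ofPath p) = Finsupp.linearCombination k (pathMul (k := k) p) :=
    (Finsupp.linearCombination_single k (1 : k) p).trans (one_smul k _)
  rw [mul_def, h1]
  exact (Finsupp.linearCombination_single k (1 : k) q).trans (one_smul k _)

theorem induction {motive : PathAlgebra k V → Prop} (x : PathAlgebra k V)
    (zero : motive 0) (add : ∀ x y, motive x → motive y → motive (x + y))
    (smul : ∀ (c : k) (p : AnyPath V), motive (c • ofPath p)) : motive x := by
  refine Finsupp.induction_linear x zero add fun p c => ?_
  have h : (Finsupp.single p c : AnyPath V →₀ k) = c • Finsupp.single p 1 := by simp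
  rw [h]
  exact smul c p

theorem pmul_assoc (p q r : AnyPath V) :
    (ofPath p * ofPath q * ofPath r : PathAlgebra k V) = ofPath p * (ofPath q * ofPath r) := by
  obtain ⟨a, b, p⟩ := p
  obtain ⟨b', c, q⟩ := q
  obtain ⟨c', d, r⟩ := r
  by_cases h : b = b'
  · subst h
    by_cases h' : c = c'
    · subst h'
      simp only [ofPath_mul, pathMul_comp, Quiver.Path.comp_assoc]
    · rw [ofPath_mul, pathMul_comp, ofPath_mul, ofPath_mul, pathMul_ne h', pathMul_ne h', mul_def,
        map_zero]
  · by_cases h' : c = c'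
    · subst h'
      rw [ofPath_mul, pathMul_ne h, ofPath_mul ⟨b', c, q⟩, pathMul_comp, ofPath_mul, pathMul_ne h,
        mul_def, map_zero, LinearMap.zero_apply]
    · rw [ofPath_mul, pathMul_ne h, ofPath_mul, pathMul_ne h', mul_def, mul_def, map_zero, map_zero,
        LinearMap.zero_apply]

theorem add_mul' (x y z : PathAlgebra k V) : (x + y) * z = x * z + y * z := by
  simp only [mul_def, map_add, LinearMap.add_apply]

theorem mul_add' (x y z : PathAlgebra k V) : x * (y + z) = x * y + x * z := by
  simp only [mul_def, map_add]

theorem smul_mul' (c : k) (x y : PathAlgebra k V) : (c • x) * y = c • (x * y) := by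
  simp only [mul_def, map_smul, LinearMap.smul_apply]

theorem mul_smul' (c : k) (x y : PathAlgebra k V) : x * (c • y) = c • (x * y) := by
  simp only [mul_def, map_smul]

theorem zero_mul' (x : PathAlgebra k V) : 0 * x = 0 := by
  simp only [mul_def, map_zero, LinearMap.zero_apply]

theorem mul_zero' (x : PathAlgebra k V) : x * 0 = 0 := by
  simp only [mul_def, map_zero]

section Ring

variable [Fintype V]

instance : One (PathAlgebra k V) := ⟨∑ v : V, ofPath ⟨v, v, Quiver.Path.nil⟩⟩

theorem one_def : (1 : PathAlgebra k V) = ∑ v : V, ofPath ⟨v, v, Quiver.Path.nil⟩ := rfl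

theorem one_mul_ofPath (p : AnyPath V) : (1 * ofPath p : PathAlgebra k V) = ofPath p := by
  obtain ⟨a, b, p⟩ := p
  rw [one_def, mul_def, map_sum, LinearMap.sum_apply, Finset.sum_eq_single a]
  · rw [← mul_def, ofPath_mul, pathMul_comp, Quiver.Path.nil_comp]
  · intro v _ hv
    rw [← mul_def, ofPath_mul, pathMul_ne hv]
  · intro h; exact absurd (Finset.mem_univ a) h

theorem ofPath_mul_one (p : AnyPath V) : (ofPath p * 1 : PathAlgebra k V) = ofPath p := by
  obtain ⟨a, b, p⟩ := p
  rw [one_def, mul_def, map_sum, Finset.sum_eq_single b]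
  · rw [← mul_def, ofPath_mul, pathMul_comp, Quiver.Path.comp_nil]
  · intro v _ hv
    rw [← mul_def, ofPath_mul, pathMul_ne hv.symm]
  · intro h; exact absurd (Finset.mem_univ b) h

instance : Ring (PathAlgebra k V) :=
  { (inferInstance : AddCommGroup (PathAlgebra k V)),
    (inferInstance : Mul (PathAlgebra k V)),
    (inferInstance : One (PathAlgebra k V)) with
    left_distrib := mul_add'
    right_distrib := add_mul'
    zero_mul := zero_mul'
    mul_zero := mul_zero'
    mul_assoc := fun x y z => by
      induction x using PathAlgebra.induction with
      | zero => simp only [zero_mul']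
      | add x x' hx hx' => simp only [add_mul', hx, hx']
      | smul c p =>
        simp only [smul_mul']
        congr 1
        induction y using PathAlgebra.induction with
        | zero => simp only [zero_mul', mul_zero']
        | add y y' hy hy' => simp only [add_mul', mul_add', hy, hy']
        | smul d q =>
          simp only [smul_mul', mul_smul']
          congr 1
          induction z using PathAlgebra.induction with
          | zero => simp only [mul_zero']
          | add z z' hz hz' => simp only [mul_add', hz, hz']
          | smul e r =>
            simp only [mul_smul']
            rw [pmul_assoc]
    one_mul := fun x => by
      induction x using PathAlgebra.induction with
      | zero => exact mul_zero' _
      | add x x' hx hx' => rw [mul_add', hx, hx']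
      | smul c p => rw [mul_smul', one_mul_ofPath]
    mul_one := fun x => by
      induction x using PathAlgebra.induction with
      | zero => exact zero_mul' _
      | add x x' hx hx' => rw [add_mul', hx, hx']
      | smul c p => rw [smul_mul', ofPath_mul_one]
    zsmul := fun n x => n • x
    zsmul_zero' := fun x => zero_zsmul x
    zsmul_succ' := fun n x => SubNegMonoid.zsmul_succ' n x
    zsmul_neg' := fun n x => SubNegMonoid.zsmul_neg' n x }

instance : Algebra k (PathAlgebra k V) := Algebra.ofModule smul_mul' mul_smul'

end Ring

/-! ### The grading by path length -/

variable (k V) in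
/-- The span of the paths of length `n`. -/
def grade (n : ℕ) : Submodule k (PathAlgebra k V) :=
  Submodule.span k (ofPath '' {p | p.length = n})

theorem ofPath_mem_grade (p : AnyPath V) : ofPath p ∈ grade k V p.length :=
  Submodule.subset_span ⟨p, rfl, rfl⟩

/-- The projection to the span of the paths satisfying a condition. -/
def filterHom (P : AnyPath V → Prop) [DecidablePred P] : PathAlgebra k V →ₗ[k] PathAlgebra k V :=
  Finsupp.linearCombination k fun p => if P p then ofPath p else 0

theorem filterHom_ofPath (P : AnyPath V → Prop) [DecidablePred P] (p : AnyPath V) :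
    (filterHom P (ofPath p) : PathAlgebra k V) = if P p then ofPath p else 0 :=
  (Finsupp.linearCombination_single k (1 : k) p).trans (one_smul k _)

theorem filterHom_of_mem {n : ℕ} (P : AnyPath V → Prop) [DecidablePred P]
    (hP : ∀ p, p.length = n → P p) {x : PathAlgebra k V} (hx : x ∈ grade k V n) :
    filterHom P x = x := by
  induction hx using Submodule.span_induction with
  | mem x hx => obtain ⟨p, hp, rfl⟩ := hx; rw [filterHom_ofPath, if_pos (hP p hp)]
  | zero => exact map_zero _
  | add x y _ _ hx hy => rw [map_add, hx, hy]
  | smul c x _ hx => rw [map_smul, hx]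

theorem filterHom_of_mem_ne {n : ℕ} (P : AnyPath V → Prop) [DecidablePred P]
    (hP : ∀ p, p.length = n → ¬ P p) {x : PathAlgebra k V} (hx : x ∈ grade k V n) :
    filterHom P x = 0 := by
  induction hx using Submodule.span_induction with
  | mem x hx => obtain ⟨p, hp, rfl⟩ := hx; rw [filterHom_ofPath, if_neg (hP p hp)]
  | zero => exact map_zero _
  | add x y _ _ hx hy => rw [map_add, hx, hy, add_zero]
  | smul c x _ hx => rw [map_smul, hx, smul_zero]

theorem exists_sum_grade (x : PathAlgebra k V) : ∃ (N : ℕ) (f : ℕ → PathAlgebra k V),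
    (∀ i, f i ∈ grade k V i) ∧ (∀ i, N ≤ i → f i = 0) ∧ x = ∑ i ∈ Finset.range N, f i := by
  induction x using PathAlgebra.induction with
  | zero => exact ⟨0, fun _ => 0, fun _ => Submodule.zero_mem _, fun _ _ => rfl, rfl⟩
  | add x y hx hy =>
    obtain ⟨N, f, h1, h2, h3⟩ := hx
    obtain ⟨N', f', h1', h2', h3'⟩ := hy
    refine ⟨max N N', fun i => f i + f' i, fun i => Submodule.add_mem _ (h1 i) (h1' i),
      fun i hi => ?_, ?_⟩
    · change f i + f' i = 0
      rw [h2 i (le_trans (le_max_left _ _) hi), h2' i (le_trans (le_max_right _ _) hi), add_zero]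
    · rw [Finset.sum_add_distrib, h3, h3']
      congr 1
      · refine Finset.sum_subset (fun i hi => ?_) fun i _ hi => h2 i (by simpa using hi)
        rw [Finset.mem_range] at hi ⊢
        exact lt_of_lt_of_le hi (le_max_left _ _)
      · refine Finset.sum_subset (fun i hi => ?_) fun i _ hi => h2' i (by simpa using hi)
        rw [Finset.mem_range] at hi ⊢
        exact lt_of_lt_of_le hi (le_max_right _ _)
  | smul c p =>
    refine ⟨p.length + 1, fun i => if i = p.length then c • ofPath p else 0, fun i => ?_,
      fun i hi => if_neg (by omega), ?_⟩
    · change (if i = p.length then c • ofPath p else 0) ∈ _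
      split_ifs with h
      · rw [h]; exact Submodule.smul_mem _ _ (ofPath_mem_grade p)
      · exact Submodule.zero_mem _
    · rw [Finset.sum_ite_eq' (Finset.range (p.length + 1)) p.length, if_pos (by simp)]

theorem isInternal_grade : DirectSum.IsInternal (grade k V) :=
  isInternal_of_proj _ (fun n => (filterHom fun p => p.length = n).toAddMonoidHom)
    (fun _ _ hx => filterHom_of_mem _ (fun _ h => h) hx)
    (fun _ _ hij _ hx => filterHom_of_mem_ne _ (fun _ h h' => hij (h'.symm.trans h)) hx)
    (fun x => by
      obtain ⟨N, f, h1, _, h3⟩ := exists_sum_grade x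
      exact ⟨_, f, h1, h3⟩)

section Graded

variable [Fintype V]

theorem grade_mul_mem {i j : ℕ} {x y : PathAlgebra k V} (hx : x ∈ grade k V i)
    (hy : y ∈ grade k V j) : x * y ∈ grade k V (i + j) := by
  induction hx using Submodule.span_induction with
  | mem x hx =>
    obtain ⟨⟨a, b, p⟩, hp, rfl⟩ := hx
    induction hy using Submodule.span_induction with
    | mem y hy =>
      obtain ⟨⟨b', c, q⟩, hq, rfl⟩ := hy
      rw [ofPath_mul]
      by_cases h : b = b'
      · subst h
        rw [pathMul_comp]
        refine Submodule.subset_span ⟨_, ?_, rfl⟩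
        change (p.comp q).length = i + j
        rw [Quiver.Path.length_comp]
        exact congrArg₂ (· + ·) hp hq
      · rw [pathMul_ne h]; exact Submodule.zero_mem _
    | zero => rw [mul_zero]; exact Submodule.zero_mem _
    | add x y _ _ hx hy => rw [mul_add]; exact Submodule.add_mem _ hx hy
    | smul c x _ hx => rw [mul_smul_comm]; exact Submodule.smul_mem _ _ hx
  | zero => rw [zero_mul]; exact Submodule.zero_mem _
  | add x y _ _ hx hy => rw [add_mul]; exact Submodule.add_mem _ hx hy
  | smul c x _ hx => rw [smul_mul_assoc]; exact Submodule.smul_mem _ _ hx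

/-- The path algebra is a graded algebra. -/
instance : GradedAlgebra (grade k V) :=
  { isInternal_grade.chooseDecomposition with
    one_mem := Submodule.sum_mem _ fun _ _ => Submodule.subset_span ⟨_, rfl, rfl⟩
    mul_mem := fun _ _ _ _ hx hy => grade_mul_mem hx hy }

end Graded

end PathAlgebra

/-! ### The quotient category -/

section QGr

variable (k : Type u) [Field k] (V : Type u) [Quiver.{u} V] [Fintype V]

/-- The category of `ℤ`-graded right modules over the path algebra. -/
abbrev GrPath := GrMod.{u} (PathAlgebra.grade k V)

theorem AnyPath.finite_length {V : Type u} [Quiver.{u} V] [Finite V]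
    [∀ a b : V, Finite (a ⟶ b)] (n : ℕ) :
    {p : AnyPath V | p.length = n}.Finite := by
  induction n with
  | zero =>
    refine (Set.finite_range fun v : V => (⟨v, v, Quiver.Path.nil⟩ : AnyPath V)).subset ?_
    rintro ⟨a, b, p⟩ hp
    cases p with
    | nil => exact ⟨a, rfl⟩
    | cons p e => exact absurd hp (Nat.succ_ne_zero _)
  | succ n ih =>
    have := ih.to_subtype
    refine (Set.finite_range fun x : Σ q : {p : AnyPath V | p.length = n}, Σ c : V, q.1.2.1 ⟶ c =>
      (⟨x.1.1.1, x.2.1, x.1.1.2.2.cons x.2.2⟩ : AnyPath V)).subset ?_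
    rintro ⟨a, b, p⟩ hp
    cases p with
    | nil => exact absurd hp.symm (Nat.succ_ne_zero _)
    | cons p e => exact ⟨⟨⟨⟨a, _, p⟩, Nat.succ_injective hp⟩, ⟨_, e⟩⟩, rfl⟩

/-- The torsion modules form a Serre class. -/
instance [∀ a b : V, Finite (a ⟶ b)] :
    (GrMod.tors (PathAlgebra.grade k V) : ObjectProperty (GrPath k V)).IsSerreClass where
  exists_zero := ⟨GrMod.zeroObj, (IsZero.iff_id_eq_zero _).2 (GrMod.hom_ext fun _ => rfl),
    fun _ => ⟨0, fun _ _ _ _ => rfl⟩⟩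
  prop_of_mono f _ h m := by
    obtain ⟨n, hn⟩ := h (f.lin m)
    refine ⟨n, fun i hi a ha => GrMod.injective_of_mono f ?_⟩
    rw [map_smul, map_zero, hn i hi a ha]
  prop_of_epi f _ h m := by
    obtain ⟨m, rfl⟩ := GrMod.surjective_of_epi f m
    obtain ⟨n, hn⟩ := h m
    refine ⟨n, fun i hi a ha => ?_⟩
    rw [← map_smul, hn i hi a ha, map_zero]
  prop_X₂_of_shortExact {S} hS h₁ h₃ m := by
    have := hS.mono_f
    have hker : ∀ x : S.X₂, S.g.lin x = 0 → ∃ y, S.f.lin y = x := by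
      intro x hx
      have h0 : GrMod.subι _ _ (GrMod.isHomog_ker S.g) ≫ S.g = 0 := GrMod.hom_ext fun x => x.2
      refine ⟨(hS.exact.lift _ h0).lin ⟨x, hx⟩, ?_⟩
      exact congrArg (fun t : S.X₂.sub _ (GrMod.isHomog_ker S.g) ⟶ S.X₂ => t.lin ⟨x, hx⟩)
        (hS.exact.lift_f _ h0)
    obtain ⟨n, hn⟩ := h₃ (S.g.lin m)
    have hp : ∀ p : AnyPath V, ∃ N : ℕ, p.length = n → ∀ i ≥ N, ∀ a ∈ PathAlgebra.grade k V i,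
        op a • op (PathAlgebra.ofPath p : PathAlgebra k V) • m = 0 := by
      intro p
      by_cases hpn : p.length = n
      · obtain ⟨y, hy⟩ := hker (op (PathAlgebra.ofPath p : PathAlgebra k V) • m) (by
          rw [map_smul]
          exact hn n le_rfl _ (hpn ▸ PathAlgebra.ofPath_mem_grade p))
        obtain ⟨N, hN⟩ := h₁ y
        refine ⟨N, fun _ i hi a ha => ?_⟩
        rw [← hy, ← map_smul, hN i hi a ha, map_zero]
      · exact ⟨0, fun h => absurd h hpn⟩
    choose N hN using hp
    obtain ⟨B, hB⟩ := ((AnyPath.finite_length (V := V) n).image N).bddAbove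
    refine ⟨n + B, fun i hi a ha => ?_⟩
    induction ha using Submodule.span_induction with
    | mem x hx =>
      obtain ⟨⟨a, b, p⟩, hp, rfl⟩ := hx
      change p.length = i at hp
      obtain ⟨c, p₁, p₂, rfl, h⟩ := p.exists_eq_comp_of_le_length (n := n) (by omega)
      rw [← PathAlgebra.pathMul_comp, ← PathAlgebra.ofPath_mul, op_mul, mul_smul]
      have h2 : B ≤ p₂.length := by
        rw [Quiver.Path.length_comp] at hp
        omega
      exact hN ⟨a, c, p₁⟩ h p₂.length (le_trans (hB ⟨_, h, rfl⟩) h2) _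
        (PathAlgebra.ofPath_mem_grade (⟨c, b, p₂⟩ : AnyPath V))
    | zero => rw [MulOpposite.op_zero, zero_smul]
    | add x y _ _ hx hy => rw [MulOpposite.op_add, add_smul, hx, hy, add_zero]
    | smul c x _ hx =>
      rw [Algebra.smul_def, Algebra.commutes, op_mul, mul_smul, hx, smul_zero]

variable [∀ a b : V, Finite (a ⟶ b)]

/-- The quotient of the category of graded right modules by the torsion modules: the
localization at the morphisms whose kernel and cokernel are torsion. -/
abbrev QGr :=
  (GrMod.tors (PathAlgebra.grade k V) : ObjectProperty (GrPath k V)).isoModSerre.Localization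

/-- The quotient functor. -/
abbrev QGr.quotient : GrPath k V ⥤ QGr k V :=
  (GrMod.tors (PathAlgebra.grade k V) : ObjectProperty (GrPath k V)).isoModSerre.Q

end QGr

/-! ### Cycles -/

section Cycles

variable {V : Type u} [Quiver.{u} V]

/-- The list of arrows of a path. -/
def pathArrows {a : V} : ∀ {b : V}, Quiver.Path a b → List (Σ x y : V, x ⟶ y)
  | _, .nil => []
  | _, .cons p e => pathArrows p ++ [⟨_, _, e⟩]

/-- A cycle: a closed path of positive length whose arrows are pairwise distinct. -/
def IsCycle {a : V} (p : Quiver.Path a a) : Prop :=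
  0 < p.length ∧ (pathArrows p).Nodup

/-- A simple cycle: a closed path `(v₀, …, vₘ = v₀)` of positive length whose vertices
`v₁, …, vₘ` are pairwise distinct. -/
def IsSimpleCycle {a : V} (p : Quiver.Path a a) : Prop :=
  0 < p.length ∧ p.vertices.tail.Nodup

/-- A cyclic vertex is one that lies on some cycle. -/
def IsCyclicVertex (v : V) : Prop :=
  ∃ (a : V) (p : Quiver.Path a a), IsCycle p ∧ v ∈ p.vertices

/-- `u` lies on a simple cycle starting at `v`. -/
def OnSimpleCycle (v u : V) : Prop :=
  ∃ p : Quiver.Path v v, IsSimpleCycle p ∧ u ∈ p.vertices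

end Cycles

/-! ### Cyclic point modules -/

section PointModules

variable (k : Type u) [Field k] {V : Type u} [Quiver.{u} V] [Fintype V]

open PathAlgebra in
variable (V) in
/-- The path algebra as a graded right module over itself. -/
def regularModule : GrPath k V where
  carrier := PathAlgebra k V
  deg i := (⨆ n : {n : ℕ // (n : ℤ) = i}, grade k V n).toAddSubgroup
  isInternal := isInternal_of_proj _
    (fun i => (filterHom fun p => (p.length : ℤ) = i).toAddMonoidHom)
    (fun i x hx => by
      have hle : (⨆ n : {n : ℕ // (n : ℤ) = i}, grade k V n) ≤
          LinearMap.eqLocus (filterHom fun p => (p.length : ℤ) = i) LinearMap.id :=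
        iSup_le fun n y hy => filterHom_of_mem _ (fun p hp => by rw [hp, n.2]) hy
      exact hle hx)
    (fun i j hij x hx => by
      have hle : (⨆ n : {n : ℕ // (n : ℤ) = j}, grade k V n) ≤
          LinearMap.ker (filterHom fun p => (p.length : ℤ) = i) :=
        iSup_le fun n y hy => filterHom_of_mem_ne _
          (fun p hp h => hij (by rw [← h, hp, n.2])) hy
      exact hle hx)
    (fun x => by
      obtain ⟨N, f, h1, _, h3⟩ := exists_sum_grade x
      refine ⟨(Finset.range N).map Nat.castEmbedding,
        fun i => if 0 ≤ i then f i.toNat else 0, fun i => ?_, ?_⟩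
      · change (if 0 ≤ i then f i.toNat else 0) ∈ ⨆ n : {n : ℕ // (n : ℤ) = i}, grade k V n
        split_ifs with h
        · exact Submodule.mem_iSup_of_mem ⟨i.toNat, Int.toNat_of_nonneg h⟩ (h1 _)
        · exact Submodule.zero_mem _
      · rw [Finset.sum_map, h3]
        refine Finset.sum_congr rfl fun n _ => ?_
        simp)
  smul_mem n i a ha m hm := by
    have hle : (⨆ n : {n : ℕ // (n : ℤ) = i}, grade k V n) ≤
        (⨆ l : {l : ℕ // (l : ℤ) = i + n}, grade k V l).comap (LinearMap.mulRight k a) :=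
      iSup_le fun l y hy => Submodule.mem_iSup_of_mem
        (p := fun l : {l : ℕ // (l : ℤ) = i + n} => grade k V l)
        ⟨l.1 + n, by rw [Nat.cast_add, l.2]⟩ (grade_mul_mem hy ha)
    exact hle hm

variable {k} in
theorem ofPath_mem_deg (p : AnyPath V) :
    PathAlgebra.ofPath p ∈ (regularModule k V).deg p.length :=
  Submodule.mem_iSup_of_mem (p := fun n : {n : ℕ // (n : ℤ) = p.length} => PathAlgebra.grade k V n)
    ⟨p.length, rfl⟩ (PathAlgebra.ofPath_mem_grade p)

/-- The right ideal `e_v kQ`. -/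
def vertexIdeal (v : V) : Submodule (PathAlgebra k V)ᵐᵒᵖ (regularModule k V) :=
  Submodule.span _ {PathAlgebra.ofPath ⟨v, v, Quiver.Path.nil⟩}

theorem isHomog_vertexIdeal (v : V) : (regularModule k V).IsHomog (vertexIdeal k v) :=
  GrMod.isHomog_span _ _ (by rintro _ rfl; exact ⟨_, ofPath_mem_deg _⟩)

/-- The graded right module `e_v kQ`. -/
def vertexModule (v : V) : GrPath k V :=
  (regularModule k V).sub (vertexIdeal k v) (isHomog_vertexIdeal k v)

/-- The right submodule generated by the paths which start at `v` and end at a vertex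
outside the simple cycle through `v`. -/
def leavingIdeal (v : V) : Submodule (PathAlgebra k V)ᵐᵒᵖ (regularModule k V) :=
  Submodule.span _ {x | ∃ (u : V) (p : Quiver.Path v u),
    ¬ OnSimpleCycle v u ∧ x = PathAlgebra.ofPath ⟨v, u, p⟩}

theorem isHomog_leavingIdeal (v : V) : (regularModule k V).IsHomog (leavingIdeal k v) :=
  GrMod.isHomog_span _ _ (by rintro _ ⟨u, p, _, rfl⟩; exact ⟨_, ofPath_mem_deg _⟩)

/-- The cyclic point module at `v`: the quotient of `e_v kQ` by the submodule generated by
the paths which start at `v` and end outside the simple cycle through `v`. -/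
def cyclicPointModule (v : V) : GrPath k V :=
  (vertexModule k v).quot ((leavingIdeal k v).comap (vertexIdeal k v).subtype) (by
    intro i m hm
    have h := isHomog_leavingIdeal k v i m.1 hm
    have h2 := GrMod.hom_proj (GrMod.subι _ _ (isHomog_vertexIdeal k v)) i m
    exact (congrArg (· ∈ leavingIdeal k v) h2).mpr h)

end PointModules

/-- A category with zero morphisms is semisimple if every object is a coproduct of a
family of simple objects. -/
def IsSemisimpleCategory (C : Type*) [Category C] [HasZeroMorphisms C] : Prop :=
  ∀ X : C, ∃ (ι : Type u) (S : ι → C) (i : ∀ j, S j ⟶ X),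
    (∀ j, Simple (S j)) ∧ Nonempty (IsColimit (Cofan.mk X i))

end

noncomputable section

/-! ### Paths in quivers -/

namespace Quiver.Path

variable {V : Type u} [Quiver.{u} V]

/-! Growth controls the cycles. If distinct arrows `e` and `f` leave a vertex, `e` returning to it
along `p` and `f` leading along `t` to a closed path `q`, then the paths `(e p)^i f t q^j` are
pairwise distinct and the path algebra grows at least quadratically (`one_lt_GKdim_of_diverge`). So
in dimension at most one every cyclic vertex has exactly one arrow that leads back to it, and a path
between cyclic vertices stays on one cycle (`isolatedCycles_of_GKdim`). The cyclic vertices are then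
permuted by a rotation ρ (`cycleRot`), and a path that stays on a cycle is determined by its start
and its length: it is `e_a σ^l`, where σ (`cycleStep`) is the sum of the arrows on cycles
(`ofPath_eq_vertexIdem_mul`).

Let ε be the sum of the idempotents at cyclic vertices. Send a graded module M to the colimit of the
M_j ε, j ≥ 0, along multiplication by σ. In degree j the coordinate v of k^n acts as the idempotent
at ρ^j v; this is compatible with σ because `e_a σ = σ e_{ρa}`. The resulting functor to modules
over k^n inverts morphisms with torsion kernel and cokernel (`orbitFunctor_inverts`), so it factors
through the quotient category. Conversely a k^n-module W is spread out as one copy of W in each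
degree j ≥ 0, with paths acting along the cycles and all other paths acting by zero. The colimit of
this module is W again (`cycleOrbitIso`).

In the other direction M is compared with the module spread out from its colimit through its core:
the elements of nonnegative degree without component at transient vertices, those that are not
cyclic but lead to a cyclic one. A path into a transient vertex is shorter than the number of
vertices, so the core differs from M by torsion (`isoModSerre_coreι`). On the core, taking germs in
every degree is linear, with torsion kernel and cokernel (`isoModSerre_coreτ`). This yields
`qgrEquivalence`.

The rest is read off from modules over the semisimple ring k^n, whose simple modules are the n
coordinate lines. The point module at v is, already as a graded module, the line at v spread along
the cycle (`pointIso`), so it corresponds to that line. -/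

theorem pathArrows_comp {a b c : V} (p : Path a b) (q : Path b c) :
    pathArrows (p.comp q) = pathArrows p ++ pathArrows q := by
  induction q with
  | nil => simp [pathArrows]
  | cons q e ih => simp [pathArrows, ih]

/-- Paths are built by appending at the end, so the first arrow is not accessible by injectivity of
constructors; in the list of arrows it is the head. -/
theorem sigma_eq_of_toPath_comp_eq {a b b' c : V} {e : a ⟶ b} {f : a ⟶ b'}
    {p : Path b c} {q : Path b' c} (h : e.toPath.comp p = f.toPath.comp q) :
    (⟨b, e⟩ : Σ x, a ⟶ x) = ⟨b', f⟩ := by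
  have h1 := congrArg pathArrows h
  rw [pathArrows_comp, pathArrows_comp] at h1
  simp only [Quiver.Hom.toPath, pathArrows, List.nil_append, List.cons_append,
    List.cons.injEq] at h1
  exact eq_of_heq (Sigma.mk.inj h1.1).2

/-- The `n`-fold repetition of a closed path. -/
def rep {a : V} (p : Path a a) : ℕ → Path a a
  | 0 => nil
  | n + 1 => p.comp (rep p n)

theorem length_rep {a : V} (p : Path a a) (n : ℕ) : (p.rep n).length = n * p.length := by
  induction n with
  | zero => simp [rep]
  | succ n ih => rw [rep, length_comp, ih]; ring

theorem rep_add {a : V} (p : Path a a) (m n : ℕ) : p.rep (m + n) = (p.rep m).comp (p.rep n) := by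
  induction m with
  | zero => simp [rep]
  | succ m ih => rw [Nat.succ_add, rep, rep, ih, comp_assoc]

/-- After cancelling the common initial segment `(e p)^i`, one path continues with `f` and the other
with `e`. -/
theorem rep_comp_ne {a b b' c : V} {e : a ⟶ b} {f : a ⟶ b'} {p : Path b a} {t : Path b' c}
    (hef : (⟨b, e⟩ : Σ x, a ⟶ x) ≠ ⟨b', f⟩) (q : Path c c) {i i' j j' : ℕ} (hi : i < i') :
    ((e.toPath.comp p).rep i).comp ((f.toPath.comp t).comp (q.rep j)) ≠
      ((e.toPath.comp p).rep i').comp ((f.toPath.comp t).comp (q.rep j')) := by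
  intro h
  obtain ⟨d, rfl⟩ := Nat.exists_eq_add_of_lt hi
  rw [add_assoc, rep_add, comp_assoc ((e.toPath.comp p).rep i), comp_inj_right, rep] at h
  simp only [comp_assoc] at h
  exact hef (sigma_eq_of_toPath_comp_eq h).symm

theorem rep_comp_injective {a b b' c : V} {e : a ⟶ b} {f : a ⟶ b'} {p : Path b a} {t : Path b' c}
    (hef : (⟨b, e⟩ : Σ x, a ⟶ x) ≠ ⟨b', f⟩) {q : Path c c} (hq : 0 < q.length) :
    Function.Injective fun x : ℕ × ℕ =>
      ((e.toPath.comp p).rep x.1).comp ((f.toPath.comp t).comp (q.rep x.2)) := by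
  rintro ⟨i, j⟩ ⟨i', j'⟩ h
  dsimp only at h
  rcases lt_trichotomy i i' with hi | rfl | hi
  · exact absurd h (rep_comp_ne hef q hi)
  · rw [comp_inj_right, comp_inj_right] at h
    have h1 := congrArg length h
    rw [length_rep, length_rep] at h1
    rw [Nat.eq_of_mul_eq_mul_right hq h1]
  · exact absurd h.symm (rep_comp_ne hef q hi)

/-- A path along which a vertex recurs after the start contains a proper detour. -/
theorem nodup_tail_or_exists_comp {a b : V} (p : Path a b) : p.vertices.tail.Nodup ∨
    ∃ (c : V) (p₁ : Path a c) (p₂ : Path c c) (p₃ : Path c b),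
      p = p₁.comp (p₂.comp p₃) ∧ 0 < p₁.length ∧ 0 < p₂.length := by
  induction p with
  | nil => left; simp
  | @cons b c p e ih =>
    rcases ih with ih | ⟨d, p₁, p₂, p₃, rfl, h1, h2⟩
    · by_cases hc : c ∈ p.vertices.tail
      · right
        obtain ⟨n, hn, hget⟩ := List.mem_iff_getElem.1 hc
        rw [List.getElem_tail] at hget
        rw [List.length_tail] at hn
        -- Position `n` in the tail is position `n + 1` in the path, so the piece before the detour
        -- is nonempty. A closed path therefore keeps positive length when the detour is removed.
        obtain ⟨v, p₁, p₂, rfl, hl, hv⟩ :=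
          p.exists_eq_comp_and_length_eq_of_lt_length (n + 1) (by omega)
        have : v = c := hv.trans hget
        subst this
        exact ⟨v, p₁, p₂.cons e, nil, rfl, by omega, by simp⟩
      · left
        rw [vertices_cons, List.concat_eq_append, List.tail_append_of_ne_nil p.vertices_ne_nil]
        exact List.Nodup.append ih (by simp) (by simpa using hc)
    · right
      exact ⟨d, p₁, p₂, p₃.cons e, by simp, h1, h2⟩

/-- Pigeonhole: a path of length `l` visits `l + 1` vertices. The preceding dichotomy sees only
repetitions after the start, so a return to the start is a separate case. -/
theorem exists_comp_of_card_le [Fintype V] {a b : V} (p : Path a b)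
    (h : Fintype.card V ≤ p.length) : ∃ (c : V) (p₁ : Path a c) (p₂ : Path c c) (p₃ : Path c b),
      p = p₁.comp (p₂.comp p₃) ∧ 0 < p₂.length := by
  rcases p.nodup_tail_or_exists_comp with h1 | ⟨c, p₁, p₂, p₃, h1, _, h2⟩
  · by_cases ha : a ∈ p.vertices.tail
    · obtain ⟨n, hn, hget⟩ := List.mem_iff_getElem.1 ha
      rw [List.getElem_tail] at hget
      rw [List.length_tail] at hn
      obtain ⟨v, p₁, p₂, rfl, hl, hv⟩ :=
        p.exists_eq_comp_and_length_eq_of_lt_length (n + 1) (by omega)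
      have : v = a := hv.trans hget
      subst this
      exact ⟨v, nil, p₁, p₂, by simp, by omega⟩
    · exfalso
      have h2 : p.vertices.Nodup := by
        rw [← List.cons_head_tail p.vertices_ne_nil, vertices_head_eq]
        exact List.nodup_cons.2 ⟨ha, h1⟩
      have := h2.length_le_card
      rw [vertices_length] at this
      omega
  · exact ⟨c, p₁, p₂, p₃, h1, h2⟩

theorem map_target_pathArrows {a b : V} (p : Path a b) :
    (pathArrows p).map (fun e => e.2.1) = p.vertices.tail := by
  induction p with
  | nil => simp [pathArrows]
  | cons p e ih =>
    rw [vertices_cons, List.concat_eq_append, List.tail_append_of_ne_nil p.vertices_ne_nil, ← ih]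
    simp [pathArrows]

/-- The built-in recursor removes the last arrow. Removing the first one keeps the end fixed and
moves the start, as needed for statements about paths that start at a cyclic vertex. -/
theorem induction_front {c : V} {motive : ∀ a : V, Path a c → Prop}
    (nil : motive c .nil)
    (comp : ∀ {a b : V} (e : a ⟶ b) (p : Path b c), motive b p → motive a (e.toPath.comp p))
    {a : V} (p : Path a c) : motive a p := by
  induction hn : p.length generalizing a with
  | zero =>
    cases p with
    | nil => exact nil
    | cons p e => simp at hn
  | succ n ih =>
    obtain ⟨b, e, q, h1, rfl⟩ := p.eq_toPath_comp_of_length_eq_succ hn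
    exact comp e q (ih q h1)

end Quiver.Path

/-! ### Cyclic vertices and closed paths -/

section Cyclic

variable {V : Type u} [Quiver.{u} V]

open Quiver (Path Reachable)

/-- Arrows with pairwise distinct targets are pairwise distinct. -/
theorem IsSimpleCycle.isCycle {a : V} {p : Path a a} (h : IsSimpleCycle p) : IsCycle p :=
  ⟨h.1, List.Nodup.of_map _ (p.map_target_pathArrows ▸ h.2)⟩

/-- Cut out detours until no vertex recurs after the start; each cut shortens the path but leaves it
nonempty. -/
theorem exists_isSimpleCycle {a : V} (p : Path a a) (hp : 0 < p.length) :
    ∃ q : Path a a, IsSimpleCycle q := by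
  induction hn : p.length using Nat.strong_induction_on generalizing p with
  | _ n ih =>
    rcases p.nodup_tail_or_exists_comp with h | ⟨c, p₁, p₂, p₃, rfl, h1, h2⟩
    · exact ⟨p, hp, h⟩
    · simp only [Quiver.Path.length_comp] at hn
      exact ih _ (by rw [Quiver.Path.length_comp]; omega) (p₁.comp p₃)
        (by rw [Quiver.Path.length_comp]; omega) rfl

/-- A cycle through `v` can be rotated to start at `v`, and conversely a closed path shortens to a
simple cycle. The criterion has no distinctness condition, so it is stable under composing paths. -/
theorem isCyclicVertex_iff {v : V} : IsCyclicVertex v ↔ ∃ p : Path v v, 0 < p.length := by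
  constructor
  · rintro ⟨a, p, ⟨hp, _⟩, hv⟩
    obtain ⟨p₁, p₂, rfl⟩ := p.exists_eq_comp_of_mem_vertices hv
    refine ⟨p₂.comp p₁, ?_⟩
    rw [Quiver.Path.length_comp] at hp ⊢
    omega
  · rintro ⟨p, hp⟩
    obtain ⟨q, hq⟩ := exists_isSimpleCycle p hp
    exact ⟨v, q, hq.isCycle, q.start_mem_vertices⟩

theorem IsCyclicVertex.of_reachable {a b : V} (ha : IsCyclicVertex a) (hab : Reachable a b)
    (hba : Reachable b a) : IsCyclicVertex b := by
  obtain ⟨p, hp⟩ := isCyclicVertex_iff.1 ha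
  obtain ⟨q⟩ := hab
  obtain ⟨r⟩ := hba
  refine isCyclicVertex_iff.2 ⟨r.comp (p.comp q), ?_⟩
  rw [Quiver.Path.length_comp, Quiver.Path.length_comp]
  omega

theorem isCyclicVertex_of_hom {a b : V} (e : a ⟶ b) (h : Reachable b a) : IsCyclicVertex a := by
  obtain ⟨p⟩ := h
  refine isCyclicVertex_iff.2 ⟨e.toPath.comp p, ?_⟩
  rw [Quiver.Path.length_comp, Quiver.Path.length_toPath]
  omega

end Cyclic

/-! ### Growth -/

section Growth

variable {k : Type u} [Field k] {V : Type u} [Quiver.{u} V]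

open Quiver (Path Reachable)

theorem PathAlgebra.linearIndependent_ofPath :
    LinearIndependent k (PathAlgebra.ofPath : AnyPath V → PathAlgebra k V) :=
  Finsupp.linearIndependent_single_one k (AnyPath V)

theorem PathAlgebra.ofPath_comp {a b c : V} (p : Path a b) (q : Path b c) :
    (ofPath ⟨a, c, p.comp q⟩ : PathAlgebra k V) = ofPath ⟨a, b, p⟩ * ofPath ⟨b, c, q⟩ := by
  rw [ofPath_mul, pathMul_comp]

variable [Fintype V]

theorem PathAlgebra.ofPath_rep_comp_mem {a c : V} {W : Submodule k (PathAlgebra k V)}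
    {p : Path a a} (hp : ofPath ⟨a, a, p⟩ ∈ W) {t : Path a c} {m : ℕ}
    (ht : ofPath ⟨a, c, t⟩ ∈ W ^ m) (i : ℕ) : ofPath ⟨a, c, (p.rep i).comp t⟩ ∈ W ^ (i + m) := by
  induction i with
  | zero => simpa [Quiver.Path.rep] using ht
  | succ i ih =>
    rw [Quiver.Path.rep, Quiver.Path.comp_assoc, ofPath_comp, Nat.succ_add, pow_succ']
    exact Submodule.mul_mem_mul hp ih

theorem PathAlgebra.ofPath_comp_rep_mem {a c : V} {W : Submodule k (PathAlgebra k V)}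
    {q : Path c c} (hq : ofPath ⟨c, c, q⟩ ∈ W) {t : Path a c} {m : ℕ}
    (ht : ofPath ⟨a, c, t⟩ ∈ W ^ m) (j : ℕ) : ofPath ⟨a, c, t.comp (q.rep j)⟩ ∈ W ^ (m + j) := by
  induction j generalizing t m with
  | zero => simpa [Quiver.Path.rep] using ht
  | succ j ih =>
    rw [Quiver.Path.rep, ← Quiver.Path.comp_assoc, ← add_assoc, add_right_comm]
    refine ih ?_
    rw [ofPath_comp, pow_succ]
    exact Submodule.mul_mem_mul ht hq

theorem powersUpTo_fg {A : Type*} [Ring A] [Algebra k A] {W : Submodule k A} (hW : W.FG) (n : ℕ) :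
    (powersUpTo W n).FG :=
  Submodule.fg_iSup _ fun _ => hW.pow _

/-- A limsup is bounded below by a bound that holds for arbitrarily large indices, so the odd ones
suffice. The constant 3/2 stands in for 2 and absorbs the factor between `n + 1` and `2 * n + 1`. -/
theorem one_lt_GKdim_of_finrank_ge {A : Type*} [Ring A] [Algebra k A] (W : Submodule k A)
    (hW : W.FG) (h : ∀ n : ℕ, (n + 1) ^ 2 ≤ Module.finrank k (powersUpTo W (2 * n + 1))) :
    1 < GKdim k A := by
  have h32 : (1 : EReal) < ((3 / 2 : ℝ) : EReal) := by
    rw [← EReal.coe_one, EReal.coe_lt_coe_iff]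
    norm_num
  refine lt_of_lt_of_le h32 (le_trans ?_ (le_iSup₂ W hW))
  refine Filter.le_limsup_of_frequently_le ?_ (by isBoundedDefault)
  rw [Filter.frequently_atTop]
  intro N
  refine ⟨2 * (N + 8) + 1, by omega, ?_⟩
  rw [EReal.coe_le_coe_iff]
  set n := N + 8
  have hd : ((n : ℝ) + 1) ^ 2 ≤ Module.finrank k (powersUpTo W (2 * n + 1)) := by
    exact_mod_cast h n
  set d := Module.finrank k (powersUpTo W (2 * n + 1))
  have hn : (8 : ℝ) ≤ (n : ℝ) + 1 := by
    have : (8 : ℝ) ≤ n := by exact_mod_cast (by omega : 8 ≤ n)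
    linarith
  have hpos : (0 : ℝ) < Real.log ((2 * n + 1 : ℕ) : ℝ) :=
    Real.log_pos (by push_cast; linarith)
  rw [le_div_iff₀ hpos]
  -- This is the 3/2 bound on logarithms, cleared of its denominator. It follows from `8 (n+1)^3 ≤
  -- (n+1)^4`, which is why the index is shifted by 8.
  have key : (((2 * n + 1 : ℕ) : ℝ)) ^ 3 ≤ (d : ℝ) ^ 2 := by
    have h1 : (((2 * n + 1 : ℕ) : ℝ)) ^ 3 ≤ (2 * ((n : ℝ) + 1)) ^ 3 := by
      refine pow_le_pow_left₀ (by positivity) ?_ 3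
      push_cast
      linarith
    have h2 : (2 * ((n : ℝ) + 1)) ^ 3 ≤ (((n : ℝ) + 1) ^ 2) ^ 2 := by
      have : 0 ≤ ((n : ℝ) + 1 - 8) * ((n : ℝ) + 1) ^ 3 :=
        mul_nonneg (by linarith) (by positivity)
      nlinarith
    have h3 : (((n : ℝ) + 1) ^ 2) ^ 2 ≤ (d : ℝ) ^ 2 := pow_le_pow_left₀ (by positivity) hd 2
    linarith
  have := Real.log_le_log (by positivity) key
  rw [Real.log_pow, Real.log_pow] at this
  push_cast at this ⊢
  linarith

/-- If two arrows leave a vertex, one leading back to it and the other to a closed path, then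
the path algebra grows at least quadratically. -/
theorem one_lt_GKdim_of_diverge {a b b' c : V} {e : a ⟶ b} {f : a ⟶ b'}
    (hef : (⟨b, e⟩ : Σ x, a ⟶ x) ≠ ⟨b', f⟩) (p : Path b a) (t : Path b' c) {q : Path c c}
    (hq : 0 < q.length) : 1 < GKdim k (PathAlgebra k V) := by
  let x : PathAlgebra k V := PathAlgebra.ofPath ⟨_, _, e.toPath.comp p⟩
  let y : PathAlgebra k V := PathAlgebra.ofPath ⟨_, _, f.toPath.comp t⟩
  let z : PathAlgebra k V := PathAlgebra.ofPath ⟨_, _, q⟩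
  let W : Submodule k (PathAlgebra k V) := Submodule.span k {x, y, z}
  have hW : W.FG := Submodule.fg_span (by simp)
  have hx : x ∈ W := Submodule.subset_span (by simp)
  have hy : y ∈ W := Submodule.subset_span (by simp)
  have hz : z ∈ W := Submodule.subset_span (by simp)
  refine one_lt_GKdim_of_finrank_ge W hW fun n => ?_
  have hmem : ∀ s : Fin (n + 1) × Fin (n + 1), PathAlgebra.ofPath ⟨a, c,
      ((e.toPath.comp p).rep s.1).comp ((f.toPath.comp t).comp (q.rep s.2))⟩ ∈
        powersUpTo W (2 * n + 1) := by
    intro s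
    -- The path is a product of `i + 1 + j` generators of `W` with `i, j ≤ n`.
    refine Submodule.mem_iSup_of_mem (⟨s.1 + (1 + s.2), by omega⟩ : Fin (2 * n + 1 + 1)) ?_
    exact PathAlgebra.ofPath_rep_comp_mem hx
      (PathAlgebra.ofPath_comp_rep_mem hz (by rw [pow_one]; exact hy) _) _
  have hinj : Function.Injective fun s : Fin (n + 1) × Fin (n + 1) => (⟨a, c,
      ((e.toPath.comp p).rep s.1).comp ((f.toPath.comp t).comp (q.rep s.2))⟩ : AnyPath V) := by
    intro s s' h
    have h1 := Path.rep_comp_injective hef hq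
      (a₁ := ((s.1 : ℕ), (s.2 : ℕ))) (a₂ := ((s'.1 : ℕ), (s'.2 : ℕ)))
      (eq_of_heq (Sigma.mk.inj (eq_of_heq (Sigma.mk.inj h).2)).2)
    exact Prod.ext (Fin.ext (Prod.mk.inj h1).1) (Fin.ext (Prod.mk.inj h1).2)
  have hli := (PathAlgebra.linearIndependent_ofPath (k := k) (V := V)).comp _ hinj
  have := Module.Finite.iff_fg.2 (powersUpTo_fg hW (2 * n + 1))
  have hli' : LinearIndependent k fun s : Fin (n + 1) × Fin (n + 1) =>
      (⟨_, hmem s⟩ : powersUpTo W (2 * n + 1)) :=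
    LinearIndependent.of_comp (powersUpTo W (2 * n + 1)).subtype hli
  have := hli'.fintype_card_le_finrank
  simpa [sq] using this

variable (V) in
/-- Each vertex emits at most one arrow leading back to it, and no path connects two
cyclic vertices unless they lie on the same cycle. -/
class IsolatedCycles : Prop where
  hom_unique : ∀ {a b b' : V} (e : a ⟶ b) (f : a ⟶ b'), Reachable b a → Reachable b' a →
    (⟨b, e⟩ : Σ x, a ⟶ x) = ⟨b', f⟩
  reachable_symm : ∀ {a b : V}, IsCyclicVertex a → IsCyclicVertex b → Reachable a b →
    Reachable b a

theorem isolatedCycles_of_GKdim (h : GKdim k (PathAlgebra k V) ≤ 1) : IsolatedCycles V where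
  hom_unique := by
    rintro a b b' e f ⟨p⟩ ⟨q⟩
    by_contra hef
    -- Here the second closed path is also based at `a`: it is `f` followed by its return.
    refine absurd (one_lt_GKdim_of_diverge (k := k) hef p q (q := f.toPath.comp q) ?_) h.not_gt
    rw [Quiver.Path.length_comp, Quiver.Path.length_toPath]
    omega
  reachable_symm := by
    rintro a c ha hc ⟨t⟩
    induction t using Quiver.Path.induction_front with
    | nil => exact ⟨.nil⟩
    | @comp a b f t ih =>
      -- If the first arrow can be undone, `b` is cyclic and the rest of the path is handled by
      -- induction. Otherwise a closed path at `a` must begin with a different arrow, and `f`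
      -- diverges from it towards the closed path at `c`.
      by_cases hb : Reachable b a
      · exact (ih (ha.of_reachable f.reachable hb)).trans hb
      · exfalso
        obtain ⟨p, hp⟩ := isCyclicVertex_iff.1 ha
        obtain ⟨q, hq⟩ := isCyclicVertex_iff.1 hc
        obtain ⟨b', e, p, _, rfl⟩ := p.eq_toPath_comp_of_length_eq_succ
          (n := p.length - 1) (by omega)
        refine absurd (one_lt_GKdim_of_diverge (k := k) (e := e) (f := f) ?_ p t hq) h.not_gt
        intro hef
        obtain rfl : b' = b := congrArg Sigma.fst hef
        exact hb ⟨p⟩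

end Growth

/-! ### The cycleRot of the cyclic vertices -/

section Rotation

open Quiver (Path Reachable)

variable (V : Type u) [Quiver.{u} V]

/-- The type of cyclic vertices. -/
abbrev CyclicVertex : Type u := {v : V // IsCyclicVertex v}

variable {V}

theorem exists_hom_reachable (a : CyclicVertex V) :
    ∃ e : Σ b, a.1 ⟶ b, Reachable e.1 a.1 := by
  obtain ⟨p, hp⟩ := isCyclicVertex_iff.1 a.2
  obtain ⟨b, e, p, _, rfl⟩ := p.eq_toPath_comp_of_length_eq_succ (n := p.length - 1) (by omega)
  exact ⟨⟨b, e⟩, ⟨p⟩⟩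

/-- An arrow that leaves a cyclic vertex along a cycle. -/
def nextArrow (a : CyclicVertex V) : Σ b, a.1 ⟶ b :=
  (exists_hom_reachable a).choose

theorem nextArrow_reachable (a : CyclicVertex V) : Reachable (nextArrow a).1 a.1 :=
  (exists_hom_reachable a).choose_spec

/-- The vertex that follows a cyclic vertex on its cycle. -/
def nextVertex (a : CyclicVertex V) : CyclicVertex V :=
  ⟨(nextArrow a).1, a.2.of_reachable (nextArrow a).2.reachable (nextArrow_reachable a)⟩

variable [IsolatedCycles V]

theorem nextArrow_eq (a : CyclicVertex V) {b : V} (e : a.1 ⟶ b) (h : Reachable b a.1) :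
    nextArrow a = ⟨b, e⟩ :=
  IsolatedCycles.hom_unique _ _ (nextArrow_reachable a) h

/-- The source of the last arrow of a closed path at `c` is cyclic, and by uniqueness that arrow is
its chosen one. On a finite set this already makes the step a permutation. -/
theorem nextVertex_surjective : Function.Surjective (nextVertex : CyclicVertex V → _) := by
  intro c
  obtain ⟨p, hp⟩ := isCyclicVertex_iff.1 c.2
  obtain ⟨a, q, e, rfl⟩ := p.length_ne_zero_iff_eq_cons.1 hp.ne'
  have h : Reachable c.1 a := ⟨q⟩
  refine ⟨⟨a, isCyclicVertex_of_hom e h⟩, Subtype.ext ?_⟩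
  exact congrArg Sigma.fst (nextArrow_eq ⟨a, isCyclicVertex_of_hom e h⟩ e h)

variable [Fintype V]

variable (V) in
/-- The permutation of the cyclic vertices that moves each one a step along its cycle. -/
def cycleRot : Equiv.Perm (CyclicVertex V) :=
  Equiv.ofBijective nextVertex (Finite.surjective_iff_bijective.1 nextVertex_surjective)

/-- The arrow from a cyclic vertex to the following one. -/
def nextHom (a : CyclicVertex V) : a.1 ⟶ (cycleRot V a).1 := (nextArrow a).2

theorem cycleRot_eq_of_hom (a : CyclicVertex V) {b : V} (e : a.1 ⟶ b) (h : Reachable b a.1) :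
    (cycleRot V a).1 = b :=
  congrArg Sigma.fst (nextArrow_eq a e h)

theorem cycleRot_pow_succ (l : ℕ) (a : CyclicVertex V) :
    (cycleRot V ^ (l + 1)) a = (cycleRot V ^ l) (cycleRot V a) := by
  rw [pow_succ, Equiv.Perm.mul_apply]

theorem reachable_cycleRot (a : CyclicVertex V) : Reachable (cycleRot V a).1 a.1 :=
  nextArrow_reachable a

theorem reachable_cycleRot_pow (l : ℕ) (a : CyclicVertex V) :
    Reachable ((cycleRot V ^ l) a).1 a.1 := by
  induction l generalizing a with
  | zero => exact .refl _
  | succ l ih =>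
    rw [cycleRot_pow_succ]
    exact (ih _).trans (reachable_cycleRot a)

/-- A path from a cyclic vertex whose end leads back to its start follows the cycle. -/
theorem cycleRot_pow_eq (a : CyclicVertex V) {b : V} (p : Path a.1 b) (h : Reachable b a.1) :
    ((cycleRot V ^ p.length) a).1 = b := by
  obtain ⟨a, ha⟩ := a
  change Path a b at p
  induction p using Quiver.Path.induction_front with
  | nil => rfl
  | @comp a b' e p ih =>
    have hb' : Reachable b' a := p.reachable.trans h
    have hr : cycleRot V ⟨a, ha⟩ = ⟨b', ha.of_reachable e.reachable hb'⟩ :=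
      Subtype.ext (cycleRot_eq_of_hom ⟨a, ha⟩ e hb')
    rw [Quiver.Path.length_comp, Quiver.Path.length_toPath, add_comm 1, cycleRot_pow_succ, hr]
    exact ih _ (h.trans e.reachable)

theorem exists_path_cycleRot_pow (a : CyclicVertex V) (l : ℕ) :
    ∃ p : Path a.1 ((cycleRot V ^ l) a).1, p.length = l := by
  induction l generalizing a with
  | zero => exact ⟨.nil, rfl⟩
  | succ l ih =>
    rw [cycleRot_pow_succ]
    obtain ⟨p, hp⟩ := ih (cycleRot V a)
    refine ⟨(nextHom a).toPath.comp p, ?_⟩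
    rw [Quiver.Path.length_comp, Quiver.Path.length_toPath, hp, add_comm]

/-- The vertices of a cycle all lie on a simple cycle through any one of them. -/
theorem onSimpleCycle_cycleRot_pow (v : CyclicVertex V) (l : ℕ) :
    OnSimpleCycle v.1 ((cycleRot V ^ l) v).1 := by
  obtain ⟨p, hp⟩ := isCyclicVertex_iff.1 v.2
  obtain ⟨q, hq⟩ := exists_isSimpleCycle p hp
  refine ⟨q, hq, ?_⟩
  have hfix : (cycleRot V ^ q.length) v = v :=
    Subtype.ext (cycleRot_pow_eq v q (.refl _))
  -- Going once around `q` fixes `v`, so only `l` modulo its length matters; the vertex is then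
  -- found at that position on `q`.
  have hmod : (cycleRot V ^ l) v = (cycleRot V ^ (l % q.length)) v := by
    conv_lhs => rw [← Nat.mod_add_div l q.length, pow_add, pow_mul, Equiv.Perm.mul_apply]
    congr 1
    generalize l / q.length = n
    induction n with
    | zero => rfl
    | succ n ih => rw [pow_succ, Equiv.Perm.mul_apply, hfix, ih]
  obtain ⟨c, q₁, q₂, h, hl⟩ := q.exists_eq_comp_of_le_length (n := l % q.length)
    (Nat.mod_lt _ hq.1).le
  rw [hmod, ← hl, cycleRot_pow_eq v q₁ ⟨q₂⟩, h, Quiver.Path.vertices_comp]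
  exact List.mem_append_right _ q₂.start_mem_vertices

end Rotation

/-! ### Elements of the path algebra attached to the cycles -/

section Elements

open Quiver (Path Reachable)
open PathAlgebra

variable (k : Type u) [Field k] {V : Type u} [Quiver.{u} V]

/-- The idempotent `e_v`. -/
def vertexIdem (v : V) : PathAlgebra k V := ofPath ⟨v, v, .nil⟩

theorem vertexIdem_mul_ofPath {a b : V} (p : Path a b) :
    vertexIdem k a * ofPath ⟨a, b, p⟩ = ofPath ⟨a, b, p⟩ := by
  rw [vertexIdem, ← ofPath_comp, Quiver.Path.nil_comp]

theorem ofPath_mul_vertexIdem {a b : V} (p : Path a b) :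
    ofPath ⟨a, b, p⟩ * vertexIdem k b = ofPath ⟨a, b, p⟩ := by
  rw [vertexIdem, ← ofPath_comp, Quiver.Path.comp_nil]

theorem vertexIdem_mul_ofPath_of_ne {a b c : V} (p : Path a b) (h : c ≠ a) :
    vertexIdem k c * ofPath ⟨a, b, p⟩ = 0 := by
  rw [vertexIdem, ofPath_mul, pathMul_ne h]

theorem ofPath_mul_vertexIdem_of_ne {a b c : V} (p : Path a b) (h : b ≠ c) :
    ofPath ⟨a, b, p⟩ * vertexIdem k c = 0 := by
  rw [vertexIdem, ofPath_mul, pathMul_ne h]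

theorem vertexIdem_mul_self (a : V) : vertexIdem k a * vertexIdem k a = vertexIdem k a :=
  vertexIdem_mul_ofPath k _

theorem vertexIdem_mul_of_ne {a b : V} (h : a ≠ b) : vertexIdem k a * vertexIdem k b = 0 :=
  vertexIdem_mul_ofPath_of_ne k _ h

theorem vertexIdem_mem_grade (a : V) : vertexIdem k a ∈ grade k V 0 :=
  ofPath_mem_grade (⟨a, a, .nil⟩ : AnyPath V)

variable [Fintype V] [IsolatedCycles V]

instance : Fintype (CyclicVertex V) := Fintype.ofFinite _

variable (V) in
/-- The sum of the arrows that lie on a cycle. -/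
def cycleStep : PathAlgebra k V :=
  ∑ a : CyclicVertex V, ofPath ⟨a.1, (cycleRot V a).1, (nextHom a).toPath⟩

/-- The action of a tuple of scalars after `j` steps: the sum of the multiples `c_v e_w`
where `w` is the vertex `j` steps after `v`. -/
def twist (j : ℕ) : (CyclicVertex V → k) →ₗ[k] PathAlgebra k V :=
  ∑ v : CyclicVertex V,
    (LinearMap.proj v : (CyclicVertex V → k) →ₗ[k] k).smulRight
      (vertexIdem k ((cycleRot V ^ j) v).1)

variable {k}

theorem twist_apply (j : ℕ) (c : CyclicVertex V → k) :
    twist k j c = ∑ v, c v • vertexIdem k ((cycleRot V ^ j) v).1 := by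
  simp [twist]

theorem cycleStep_mem_grade : cycleStep k V ∈ grade k V 1 :=
  Submodule.sum_mem _ fun a _ =>
    ofPath_mem_grade (⟨a.1, (cycleRot V a).1, (nextHom a).toPath⟩ : AnyPath V)

theorem cycleStep_pow_mem_grade (l : ℕ) : cycleStep k V ^ l ∈ grade k V l := by
  have := SetLike.pow_mem_graded (A := grade k V) l (cycleStep_mem_grade (k := k) (V := V))
  simpa using this

theorem twist_mem_grade (j : ℕ) (c : CyclicVertex V → k) : twist k j c ∈ grade k V 0 := by
  rw [twist_apply]
  exact Submodule.sum_mem _ fun _ _ => Submodule.smul_mem _ _ (vertexIdem_mem_grade k _)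

theorem vertexIdem_mul_cycleStep (a : CyclicVertex V) :
    vertexIdem k a.1 * cycleStep k V = ofPath ⟨a.1, (cycleRot V a).1, (nextHom a).toPath⟩ := by
  rw [cycleStep, Finset.mul_sum, Finset.sum_eq_single a]
  · exact vertexIdem_mul_ofPath k _
  · intro b _ hb
    exact vertexIdem_mul_ofPath_of_ne k _ fun h => hb (Subtype.ext h.symm)
  · simp

theorem cycleStep_mul_vertexIdem (a : CyclicVertex V) :
    cycleStep k V * vertexIdem k (cycleRot V a).1 =
      ofPath ⟨a.1, (cycleRot V a).1, (nextHom a).toPath⟩ := by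
  rw [cycleStep, Finset.sum_mul, Finset.sum_eq_single a]
  · exact ofPath_mul_vertexIdem k _
  · intro b _ hb
    exact ofPath_mul_vertexIdem_of_ne k _ fun h =>
      hb ((cycleRot V).injective (Subtype.ext h))
  · simp

/-- The only arrow in `cycleStep` that leaves `a` is also the only one that enters the next vertex,
so an idempotent passes through a step by being rotated. -/
theorem vertexIdem_mul_cycleStep_comm (a : CyclicVertex V) (l : ℕ) :
    vertexIdem k a.1 * cycleStep k V ^ l =
      cycleStep k V ^ l * vertexIdem k ((cycleRot V ^ l) a).1 := by
  induction l generalizing a with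
  | zero => simp
  | succ l ih =>
    rw [pow_succ', ← mul_assoc, vertexIdem_mul_cycleStep, ← cycleStep_mul_vertexIdem, mul_assoc,
      ih, ← mul_assoc, cycleRot_pow_succ]

/-- Every intermediate vertex of such a path leads back to the start, so each arrow is the forced
one. -/
theorem ofPath_eq_vertexIdem_mul (a : CyclicVertex V) {b : V} (p : Path a.1 b)
    (h : Reachable b a.1) :
    (ofPath ⟨a.1, b, p⟩ : PathAlgebra k V) = vertexIdem k a.1 * cycleStep k V ^ p.length := by
  obtain ⟨a, ha⟩ := a
  change Path a b at p
  change (ofPath ⟨a, b, p⟩ : PathAlgebra k V) = vertexIdem k a * _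
  induction p using Quiver.Path.induction_front with
  | nil => rw [Quiver.Path.length_nil, pow_zero, mul_one]; rfl
  | @comp a b' e p ih =>
    have hb' : Reachable b' a := p.reachable.trans h
    have hn := nextArrow_eq ⟨a, ha⟩ e hb'
    have he : (ofPath ⟨a, b', e.toPath⟩ : PathAlgebra k V) = vertexIdem k a * cycleStep k V := by
      refine Eq.trans ?_ (vertexIdem_mul_cycleStep ⟨a, ha⟩).symm
      exact congrArg (fun x : Σ b, a ⟶ b => (ofPath ⟨a, x.1, x.2.toPath⟩ : PathAlgebra k V)) hn.symm
    rw [ofPath_comp, ih (ha.of_reachable e.reachable hb') (h.trans e.reachable), ← mul_assoc,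
      ofPath_mul_vertexIdem, he, mul_assoc, ← pow_succ', Quiver.Path.length_comp,
      Quiver.Path.length_toPath, add_comm 1]

theorem ofPath_eq_mul_vertexIdem (a : CyclicVertex V) {b : V} (p : Path a.1 b)
    (h : Reachable b a.1) :
    (ofPath ⟨a.1, b, p⟩ : PathAlgebra k V) = cycleStep k V ^ p.length * vertexIdem k b := by
  rw [ofPath_eq_vertexIdem_mul a p h, vertexIdem_mul_cycleStep_comm, cycleRot_pow_eq a p h]

theorem twist_mul (j : ℕ) (c d : CyclicVertex V → k) :
    twist k j (c * d) = twist k j c * twist k j d := by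
  simp only [twist_apply, Finset.sum_mul, Finset.mul_sum]
  refine Finset.sum_congr rfl fun v _ => ?_
  rw [Finset.sum_eq_single v]
  · rw [smul_mul_smul_comm, vertexIdem_mul_self, Pi.mul_apply]
  · intro w _ hw
    rw [smul_mul_smul_comm, vertexIdem_mul_of_ne, smul_zero]
    exact fun h => hw ((cycleRot V ^ j).injective (Subtype.ext h))
  · simp

/-- This shift of index is the compatibility that makes the tuples of scalars act on the colimit. -/
theorem twist_mul_cycleStep_pow (j l : ℕ) (c : CyclicVertex V → k) :
    twist k j c * cycleStep k V ^ l = cycleStep k V ^ l * twist k (j + l) c := by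
  simp only [twist_apply, Finset.sum_mul, Finset.mul_sum]
  refine Finset.sum_congr rfl fun v _ => ?_
  rw [smul_mul_assoc, mul_smul_comm, vertexIdem_mul_cycleStep_comm, ← Equiv.Perm.mul_apply,
    ← pow_add, add_comm l j]

/-- Rotation only permutes the summands, so the unit tuple gives the same idempotent for all `j`:
the projection to the cyclic vertices. -/
theorem twist_one (j : ℕ) : twist k j 1 = ∑ v : CyclicVertex V, vertexIdem k v.1 := by
  rw [twist_apply]
  simp only [Pi.one_apply, one_smul]
  exact Equiv.sum_comp (cycleRot V ^ j) fun v => vertexIdem k v.1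

theorem twist_one_eq (i j : ℕ) : twist k i (1 : CyclicVertex V → k) = twist k j 1 := by
  rw [twist_one, twist_one]

theorem twist_one_mul_cycleStep (j : ℕ) : twist k j 1 * cycleStep k V = cycleStep k V := by
  rw [twist_one, Finset.sum_mul, cycleStep]
  exact Finset.sum_congr rfl fun v _ => vertexIdem_mul_cycleStep v

/-- The indicator of the set of vertices from which `a` is reached in `i` steps of the cycleRot. -/
def orbitIndicator (k : Type u) [Field k] (i : ℕ) (a : V) : CyclicVertex V → k :=
  open Classical in fun v => if ((cycleRot V ^ i) v).1 = a then 1 else 0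

theorem orbitIndicator_of_not_cyclic (i : ℕ) {a : V} (ha : ¬ IsCyclicVertex a) :
    orbitIndicator k i a = 0 := by
  funext v
  refine if_neg fun h => ha ?_
  rw [← h]
  exact ((cycleRot V ^ i) v).2

theorem orbitIndicator_cycleRot_pow (i : ℕ) (v : CyclicVertex V) [DecidableEq (CyclicVertex V)] :
    orbitIndicator k i ((cycleRot V ^ i) v).1 = Pi.single v 1 := by
  funext w
  rw [Pi.single_apply, orbitIndicator]
  congr 1
  rw [eq_iff_iff, ← Subtype.ext_iff, (cycleRot V ^ i).injective.eq_iff]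

theorem twist_single [DecidableEq (CyclicVertex V)] (j : ℕ) (v : CyclicVertex V) (c : k) :
    twist k j (Pi.single v c) = c • vertexIdem k ((cycleRot V ^ j) v).1 := by
  rw [twist_apply, Finset.sum_eq_single v]
  · rw [Pi.single_eq_same]
  · intro w _ hw
    rw [Pi.single_eq_of_ne hw, zero_smul]
  · simp

theorem twist_orbitIndicator (i : ℕ) {a : V} (ha : IsCyclicVertex a) :
    twist k i (orbitIndicator k i a) = vertexIdem k a := by
  classical
  obtain ⟨v, hv⟩ := (cycleRot V ^ i).surjective ⟨a, ha⟩
  obtain rfl : a = ((cycleRot V ^ i) v).1 := by rw [hv]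
  rw [orbitIndicator_cycleRot_pow, twist_single, one_smul]

theorem sum_orbitIndicator (i : ℕ) : ∑ a : V, orbitIndicator k i a = 1 := by
  classical
  funext v
  simp [orbitIndicator, Finset.sum_apply]

theorem orbitIndicator_mul_of_path {a b : V} (p : Path a b) (h : Reachable b a) (i : ℕ) :
    orbitIndicator k (i + p.length) b * orbitIndicator k i a = orbitIndicator k i a := by
  funext v
  simp only [orbitIndicator, Pi.mul_apply]
  by_cases hv : ((cycleRot V ^ i) v).1 = a
  · subst hv
    have := cycleRot_pow_eq _ p h
    rw [← Equiv.Perm.mul_apply, ← pow_add, add_comm] at this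
    rw [if_pos this, one_mul]
  · rw [if_neg hv, mul_zero]

theorem orbitIndicator_mul_of_ne {a b c : V} (p : Path a b) (h : Reachable b a) (i : ℕ)
    (hc : b ≠ c) : orbitIndicator k (i + p.length) c * orbitIndicator k i a = 0 := by
  funext v
  simp only [orbitIndicator, Pi.mul_apply, Pi.zero_apply]
  by_cases hv : ((cycleRot V ^ i) v).1 = a
  · subst hv
    have := cycleRot_pow_eq _ p h
    rw [← Equiv.Perm.mul_apply, ← pow_add, add_comm] at this
    rw [if_neg (fun h => hc (this.symm.trans h)), zero_mul]
  · rw [if_neg hv, mul_zero]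

end Elements

/-! ### The limit of a graded module along the cycles -/

section OrbitLimit

open Quiver (Path Reachable)
open PathAlgebra

variable {k : Type u} [Field k] {V : Type u} [Quiver.{u} V] [Fintype V]

theorem smul_mem_deg_zero {M : GrPath k V} {a : PathAlgebra k V} (ha : a ∈ grade k V 0) {i : ℤ} {m : M}
    (hm : m ∈ M.deg i) : op a • m ∈ M.deg i := by
  simpa using M.smul_mem 0 i a ha m hm

variable [IsolatedCycles V]

/-- The sequences `m` with `m j` of degree `j` and supported at the cyclic vertices, such that
eventually each term is obtained from the preceding one by a step along the cycles. -/
def orbitSeq (M : GrPath k V) : AddSubgroup (ℕ → M) where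
  carrier := {m | (∀ j : ℕ, m j ∈ M.deg j ∧ op (twist k j (1 : CyclicVertex V → k)) • m j = m j) ∧
    ∃ N, ∀ j ≥ N, m (j + 1) = op (cycleStep k V) • m j}
  zero_mem' := ⟨fun _ => ⟨zero_mem _, smul_zero _⟩, 0, fun _ _ => (smul_zero _).symm⟩
  add_mem' := by
    rintro m m' ⟨h, N, hN⟩ ⟨h', N', hN'⟩
    refine ⟨fun j => ⟨add_mem (h j).1 (h' j).1, ?_⟩, max N N', fun j hj => ?_⟩
    · rw [Pi.add_apply, smul_add, (h j).2, (h' j).2]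
    · rw [Pi.add_apply, Pi.add_apply, smul_add, hN j (le_trans (le_max_left _ _) hj),
        hN' j (le_trans (le_max_right _ _) hj)]
  neg_mem' := by
    rintro m ⟨h, N, hN⟩
    refine ⟨fun j => ⟨neg_mem (h j).1, ?_⟩, N, fun j hj => ?_⟩
    · rw [Pi.neg_apply, smul_neg, (h j).2]
    · rw [Pi.neg_apply, Pi.neg_apply, smul_neg, hN j hj]

variable {M N : GrPath k V}

instance : SMul (CyclicVertex V → k) (orbitSeq M) where
  smul c m := ⟨fun j => op (twist k j c) • m.1 j, by
    obtain ⟨m, h, N, hN⟩ := m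
    refine ⟨fun j => ⟨smul_mem_deg_zero (twist_mem_grade j c) (h j).1, ?_⟩, N, fun j hj => ?_⟩
    · rw [← mul_smul, ← op_mul, ← twist_mul, mul_one]
    · have := twist_mul_cycleStep_pow j 1 c
      rw [pow_one] at this
      dsimp only
      rw [hN j hj, ← mul_smul, ← mul_smul, ← op_mul, ← op_mul, this]⟩

theorem orbitSeq_smul_apply (c : CyclicVertex V → k) (m : orbitSeq M) (j : ℕ) :
    (c • m).1 j = op (twist k j c) • m.1 j := rfl

theorem orbitSeq_ext {m m' : orbitSeq M} (h : ∀ j, m.1 j = m'.1 j) : m = m' :=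
  Subtype.ext (funext h)

theorem orbitSeq_add_apply (m m' : orbitSeq M) (j : ℕ) : (m + m').1 j = m.1 j + m'.1 j := rfl

instance : Module (CyclicVertex V → k) (orbitSeq M) where
  one_smul m := orbitSeq_ext fun j => (m.2.1 j).2
  mul_smul c d m := orbitSeq_ext fun j => by
    rw [orbitSeq_smul_apply, orbitSeq_smul_apply, orbitSeq_smul_apply, ← mul_smul, ← op_mul,
      ← twist_mul, mul_comm]
  smul_zero c := orbitSeq_ext fun j => smul_zero _
  smul_add c m m' := orbitSeq_ext fun j => smul_add _ _ _
  add_smul c d m := orbitSeq_ext fun j => by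
    simp only [orbitSeq_smul_apply, orbitSeq_add_apply, map_add, MulOpposite.op_add, add_smul]
  zero_smul m := orbitSeq_ext fun j => by
    rw [orbitSeq_smul_apply, map_zero, MulOpposite.op_zero, zero_smul]; rfl

variable (M) in
/-- The sequences that are eventually zero. -/
def orbitNull : Submodule (CyclicVertex V → k) (orbitSeq M) where
  carrier := {m | ∃ N, ∀ j ≥ N, m.1 j = 0}
  zero_mem' := ⟨0, fun _ _ => rfl⟩
  add_mem' := by
    rintro m m' ⟨N, hN⟩ ⟨N', hN'⟩
    refine ⟨max N N', fun j hj => ?_⟩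
    rw [orbitSeq_add_apply, hN j (le_trans (le_max_left _ _) hj),
      hN' j (le_trans (le_max_right _ _) hj), add_zero]
  smul_mem' := by
    rintro c m ⟨N, hN⟩
    exact ⟨N, fun j hj => by rw [orbitSeq_smul_apply, hN j hj, smul_zero]⟩

variable (M) in
/-- The colimit of the pieces of `M` along the rotation of the cyclic vertices. -/
abbrev OrbitLimit : Type u := orbitSeq M ⧸ orbitNull M

theorem orbitSeq_step_pow {m : orbitSeq M} {N : ℕ}
    (hN : ∀ j ≥ N, m.1 (j + 1) = op (cycleStep k V) • m.1 j) (j l : ℕ) (hj : N ≤ j) :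
    m.1 (j + l) = op (cycleStep k V ^ l) • m.1 j := by
  induction l with
  | zero => rw [pow_zero, op_one, one_smul, add_zero]
  | succ l ih => rw [← add_assoc, hN _ (by omega), ih, ← mul_smul, ← op_mul, pow_succ]

/-- The map induced on sequences. -/
def orbitSeqMap (f : M ⟶ N) : orbitSeq M →ₗ[CyclicVertex V → k] orbitSeq N where
  toFun m := ⟨fun j => f.lin (m.1 j), fun j =>
    ⟨f.map_mem _ _ (m.2.1 j).1, by rw [← map_smul, (m.2.1 j).2]⟩, by
      obtain ⟨N, hN⟩ := m.2.2
      exact ⟨N, fun j hj => by dsimp only; rw [hN j hj, map_smul]⟩⟩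
  map_add' _ _ := orbitSeq_ext fun _ => map_add _ _ _
  map_smul' _ _ := orbitSeq_ext fun _ => map_smul _ _ _

theorem orbitNull_le_comap (f : M ⟶ N) : orbitNull M ≤ (orbitNull N).comap (orbitSeqMap f) := by
  rintro m ⟨N, hN⟩
  refine ⟨N, fun j hj => ?_⟩
  change f.lin (m.1 j) = 0
  rw [hN j hj, map_zero]

/-- The map induced on the limits along the cycles. -/
def orbitLimitMap (f : M ⟶ N) : OrbitLimit M →ₗ[CyclicVertex V → k] OrbitLimit N :=
  Submodule.mapQ _ _ (orbitSeqMap f) (orbitNull_le_comap f)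

variable (k V) in
/-- The limit along the cycles as a functor. -/
def orbitFunctor : GrPath k V ⥤ ModuleCat.{u} (CyclicVertex V → k) where
  obj M := ModuleCat.of _ (OrbitLimit M)
  map f := ModuleCat.ofHom (orbitLimitMap f)
  map_id M := by
    ext
    rfl
  map_comp f g := by
    ext
    rfl

/-- The sequence starts in degree `j` with the part of `m` at cyclic vertices and then follows the
steps. The zeros before `j` are harmless, since the step relation is only required eventually. -/
theorem germSeq_mem (j : ℕ) (m : M) : (fun i : ℕ => if j ≤ i then
      op (twist k j (1 : CyclicVertex V → k) * cycleStep k V ^ (i - j)) • M.proj j m else 0) ∈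
    orbitSeq M := by
  refine ⟨fun i => ?_, j, fun i hi => ?_⟩
  · dsimp only
    split_ifs with h
    · constructor
      · have h1 := smul_mem_deg_zero (twist_mem_grade j (1 : CyclicVertex V → k))
          (GrMod.proj_mem (j : ℤ) m)
        have h2 := M.smul_mem _ _ _ (cycleStep_pow_mem_grade (k := k) (V := V) (i - j)) _ h1
        rw [← mul_smul, ← op_mul] at h2
        convert h2 using 2
        omega
      · rw [← mul_smul, ← op_mul, mul_assoc, twist_one_eq i (j + (i - j)),
          ← twist_mul_cycleStep_pow, ← mul_assoc, ← twist_mul, mul_one]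
    · exact ⟨zero_mem _, smul_zero _⟩
  · dsimp only
    rw [if_pos hi, if_pos (by omega), ← mul_smul, ← op_mul, mul_assoc, ← pow_succ,
      Nat.succ_sub hi]

variable (M) in
/-- The element of the limit represented by the degree `j` component of an element. -/
def germ (j : ℕ) : M →+ OrbitLimit M where
  toFun m := (orbitNull M).mkQ ⟨_, germSeq_mem j m⟩
  map_zero' := by
    refine (congrArg (orbitNull M).mkQ (orbitSeq_ext fun i => ?_)).trans (map_zero _)
    dsimp only
    rw [map_zero, smul_zero, ite_self]
    rfl
  map_add' m m' := by
    rw [← map_add]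
    refine congrArg (orbitNull M).mkQ (orbitSeq_ext fun i => ?_)
    rw [orbitSeq_add_apply]
    dsimp only
    split_ifs
    · rw [map_add, smul_add]
    · rw [add_zero]

theorem mkQ_eq_of_eventually {m m' : orbitSeq M} (N : ℕ) (h : ∀ j ≥ N, m.1 j = m'.1 j) :
    (orbitNull M).mkQ m = (orbitNull M).mkQ m' := by
  rw [← sub_eq_zero, ← map_sub]
  refine (Submodule.Quotient.mk_eq_zero _).2 ⟨N, fun j hj => ?_⟩
  change m.1 j - m'.1 j = 0
  rw [h j hj, sub_self]

theorem smul_germ (c : CyclicVertex V → k) (j : ℕ) (m : M) :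
    c • germ M j m = germ M j (op (twist k j c) • m) := by
  refine (map_smul (orbitNull M).mkQ c _).symm.trans
    (congrArg (orbitNull M).mkQ (orbitSeq_ext fun i => ?_))
  rw [orbitSeq_smul_apply]
  dsimp only
  split_ifs with h
  · have hp := GrMod.proj_smul (M := M) (twist_mem_grade j c) j m
    rw [Nat.cast_zero, sub_zero] at hp
    obtain ⟨l, rfl⟩ := Nat.exists_eq_add_of_le h
    rw [hp, ← mul_smul, ← mul_smul, ← op_mul, ← op_mul, Nat.add_sub_cancel_left, mul_assoc,
      ← twist_mul_cycleStep_pow, ← mul_assoc, ← mul_assoc, ← twist_mul, ← twist_mul, mul_comm]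
  · rw [smul_zero]

theorem germ_eq_zero_iff {j : ℕ} {m : M} : germ M j m = 0 ↔
    ∃ l, op (twist k j (1 : CyclicVertex V → k) * cycleStep k V ^ l) • M.proj j m = 0 := by
  constructor
  · intro h
    obtain ⟨N, hN⟩ := (Submodule.Quotient.mk_eq_zero _).1 h
    have := hN (j + N) (by omega)
    dsimp only at this
    rw [if_pos (by omega), Nat.add_sub_cancel_left] at this
    exact ⟨N, this⟩
  · rintro ⟨l, hl⟩
    refine (Submodule.Quotient.mk_eq_zero _).2 ⟨j + l, fun i hi => ?_⟩
    dsimp only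
    rw [if_pos (by omega), show i - j = l + (i - j - l) by omega, pow_add, ← mul_assoc, op_mul,
      mul_smul, hl, smul_zero]

/-- A sequence represents the same class as the germ of any of its late terms. The freedom to
prescribe the large degree `j` is what later makes the cokernel of `coreτ` torsion. -/
theorem exists_germ_eq (w : OrbitLimit M) : ∃ N : ℕ, ∀ j ≥ N, ∃ m ∈ M.deg j,
    op (twist k j (1 : CyclicVertex V → k)) • m = m ∧ germ M j m = w := by
  obtain ⟨s, rfl⟩ := (orbitNull M).mkQ_surjective w
  obtain ⟨N, hN⟩ := s.2.2
  refine ⟨N, fun j hj => ⟨s.1 j, (s.2.1 j).1, (s.2.1 j).2, ?_⟩⟩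
  refine mkQ_eq_of_eventually j fun i hi => ?_
  obtain ⟨l, rfl⟩ := Nat.exists_eq_add_of_le hi
  dsimp only
  rw [if_pos hi, Nat.add_sub_cancel_left, GrMod.proj_same (s.2.1 j).1, op_mul, mul_smul,
    (s.2.1 j).2, orbitSeq_step_pow hN j l hj]

theorem germ_cycleStep_pow (j l : ℕ) (m : M) :
    germ M (j + l) (op (cycleStep k V ^ l) • m) = germ M j m := by
  refine mkQ_eq_of_eventually (j + l) fun i hi => ?_
  obtain ⟨n, rfl⟩ := Nat.exists_eq_add_of_le hi
  have hp := GrMod.proj_smul (M := M) (cycleStep_pow_mem_grade (k := k) (V := V) l) (j + l : ℕ) m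
  have h1 : ((j + l : ℕ) : ℤ) - l = j := by push_cast; ring
  rw [h1] at hp
  dsimp only
  rw [if_pos (by omega), if_pos (by omega), hp, ← mul_smul, ← op_mul, Nat.add_sub_cancel_left,
    ← mul_assoc, ← twist_mul_cycleStep_pow, mul_assoc, ← pow_add, add_assoc,
    Nat.add_sub_cancel_left]

theorem orbitLimitMap_germ (f : M ⟶ N) (j : ℕ) (m : M) :
    orbitLimitMap f (germ M j m) = germ N j (f.lin m) := by
  refine congrArg (orbitNull N).mkQ (orbitSeq_ext fun i => ?_)
  change f.lin (ite _ _ _) = ite _ _ _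
  split_ifs with h
  · rw [map_smul, GrMod.hom_proj]
  · rw [map_zero]

theorem germ_proj (j : ℕ) (m : M) : germ M j (M.proj j m) = germ M j m := by
  refine congrArg (orbitNull M).mkQ (orbitSeq_ext fun i => ?_)
  dsimp only
  rw [GrMod.proj_same (GrMod.proj_mem (j : ℤ) m)]

end OrbitLimit

/-! ### Morphisms with torsion kernel and cokernel -/

section Serre

open PathAlgebra

variable {k : Type u} [Field k] {V : Type u} [Quiver.{u} V] [Fintype V]
  [∀ a b : V, Finite (a ⟶ b)] {M N : GrPath k V}

/-- The abstract kernel and cokernel are isomorphic to the graded submodule and quotient, where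
torsion can be tested on elements. -/
theorem isoModSerre_iff_elements (f : M ⟶ N) :
    (GrMod.tors (grade k V) : ObjectProperty (GrPath k V)).isoModSerre f ↔
      (∀ m, f.lin m = 0 → ∃ n : ℕ, ∀ i ≥ n, ∀ a ∈ grade k V i, op a • m = 0) ∧
      (∀ x, ∃ n : ℕ, ∀ i ≥ n, ∀ a ∈ grade k V i, op a • x ∈ LinearMap.range f.lin) := by
  rw [ObjectProperty.isoModSerre_iff, ObjectProperty.monoModSerre_iff,
    ObjectProperty.epiModSerre_iff]
  have hker : IsLimit (KernelFork.ofι (f := f) (GrMod.subι _ _ (GrMod.isHomog_ker f))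
      (GrMod.hom_ext fun m => m.2)) := KernelFork.IsLimit.ofι _ _
    (fun {W} g hg => ⟨LinearMap.codRestrict _ g.lin fun x =>
      congrArg (fun t : W ⟶ _ => t.lin x) hg, fun i m h => g.map_mem i m h⟩)
    (fun _ _ => rfl)
    (fun _ _ _ hm => GrMod.hom_ext fun x => Subtype.ext
      (congrArg (fun t => GrMod.Hom.lin t x) hm))
  have hcoker : IsColimit (CokernelCofork.ofπ (f := f) (GrMod.quotπ _ _ (GrMod.isHomog_range f))
      (GrMod.hom_ext fun m => (Submodule.Quotient.mk_eq_zero _).2 ⟨m, rfl⟩)) :=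
    CokernelCofork.IsColimit.ofπ _ _
    (fun {W} g hg => ⟨Submodule.liftQ _ g.lin (by
      rintro _ ⟨x, rfl⟩
      exact congrArg (fun t => GrMod.Hom.lin t x) hg), by
      rintro i _ ⟨x, hx, rfl⟩
      exact g.map_mem i x hx⟩)
    (fun _ _ => rfl)
    (fun _ _ _ hm => GrMod.hom_ext fun x => by
      obtain ⟨x, rfl⟩ := Submodule.mkQ_surjective _ x
      exact congrArg (fun t => GrMod.Hom.lin t x) hm)
  have e1 : kernel f ≅ M.sub _ (GrMod.isHomog_ker f) :=
    (kernelIsKernel f).conePointUniqueUpToIso hker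
  have e2 : cokernel f ≅ N.quot _ (GrMod.isHomog_range f) :=
    (cokernelIsCokernel f).coconePointUniqueUpToIso hcoker
  rw [ObjectProperty.prop_iff_of_iso (GrMod.tors (grade k V)) e1,
    ObjectProperty.prop_iff_of_iso (GrMod.tors (grade k V)) e2]
  refine and_congr ⟨fun h m hm => ?_, fun h m => ?_⟩ ⟨fun h x => ?_, fun h x => ?_⟩
  · obtain ⟨n, hn⟩ := h ⟨m, hm⟩
    exact ⟨n, fun i hi a ha => congrArg Subtype.val (hn i hi a ha)⟩
  · obtain ⟨n, hn⟩ := h m.1 m.2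
    exact ⟨n, fun i hi a ha => Subtype.ext (hn i hi a ha)⟩
  · obtain ⟨n, hn⟩ := h (Submodule.Quotient.mk x)
    exact ⟨n, fun i hi a ha => (Submodule.Quotient.mk_eq_zero _).1 (hn i hi a ha)⟩
  · obtain ⟨x, rfl⟩ := Submodule.mkQ_surjective _ x
    obtain ⟨n, hn⟩ := h x
    exact ⟨n, fun i hi a ha => (Submodule.Quotient.mk_eq_zero _).2 (hn i hi a ha)⟩

variable [IsolatedCycles V]

/-- Since `cycleStep ^ l` is homogeneous of degree `l`, a high power kills any torsion element of
the kernel and moves any element of the target into the image. Neither operation changes the germ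
once degrees are shifted accordingly. -/
theorem orbitFunctor_inverts :
    (GrMod.tors (grade k V) : ObjectProperty (GrPath k V)).isoModSerre.IsInvertedBy
      (orbitFunctor k V) := by
  intro M N f hf
  obtain ⟨h1, h2⟩ := (isoModSerre_iff_elements f).1 hf
  rw [ConcreteCategory.isIso_iff_bijective]
  change Function.Bijective (orbitLimitMap f)
  constructor
  · rw [injective_iff_map_eq_zero]
    intro w hw
    obtain ⟨j, hj⟩ := exists_germ_eq w
    obtain ⟨m, hm, he, rfl⟩ := hj j le_rfl
    rw [orbitLimitMap_germ, germ_eq_zero_iff] at hw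
    obtain ⟨l, hl⟩ := hw
    rw [← GrMod.hom_proj, GrMod.proj_same hm, op_mul, mul_smul, ← map_smul, he, ← map_smul] at hl
    obtain ⟨n, hn⟩ := h1 _ hl
    rw [germ_eq_zero_iff]
    refine ⟨l + n, ?_⟩
    rw [GrMod.proj_same hm, op_mul, mul_smul, he, pow_add, op_mul, mul_smul]
    exact hn n le_rfl _ (cycleStep_pow_mem_grade n)
  · intro w
    obtain ⟨j, hj⟩ := exists_germ_eq w
    obtain ⟨y, hy, he, rfl⟩ := hj j le_rfl
    obtain ⟨l, hl⟩ := h2 y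
    obtain ⟨m, hm⟩ := hl l le_rfl _ (cycleStep_pow_mem_grade l)
    refine ⟨germ M (j + l) m, ?_⟩
    rw [orbitLimitMap_germ, hm, germ_cycleStep_pow]

end Serre

/-! ### Graded modules spread along the cycles -/

section CycleModule

open Quiver (Path Reachable)
open PathAlgebra

variable {k : Type u} [Field k] {V : Type u} [Quiver.{u} V] [Fintype V]

/-- Extend a multiplicative function on paths to an anti-homomorphism of the path algebra. -/
def PathAlgebra.opLift {B : Type*} [Ring B] [Algebra k B] (act : AnyPath V → B)
    (h_one : ∑ v, act ⟨v, v, .nil⟩ = 1)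
    (h_comp : ∀ {a b c : V} (p : Path a b) (q : Path b c),
      act ⟨a, c, p.comp q⟩ = act ⟨b, c, q⟩ * act ⟨a, b, p⟩)
    (h_ne : ∀ p q : AnyPath V, p.2.1 ≠ q.1 → act q * act p = 0) :
    (PathAlgebra k V)ᵐᵒᵖ →+* B :=
  let φ : PathAlgebra k V →ₗ[k] B := Finsupp.linearCombination k act
  have hφ : ∀ p, φ (ofPath p) = act p := fun p =>
    (Finsupp.linearCombination_single k (1 : k) p).trans (one_smul k _)
  { toFun := fun a => φ a.unop
    map_zero' := map_zero φ
    map_add' := fun a b => map_add φ a.unop b.unop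
    map_one' := by
      rw [unop_one, one_def, map_sum, ← h_one]
      exact Finset.sum_congr rfl fun v _ => hφ _
    map_mul' := fun x y => by
      obtain ⟨x, rfl⟩ := op_surjective x
      obtain ⟨y, rfl⟩ := op_surjective y
      rw [← op_mul, unop_op, unop_op, unop_op]
      induction x using PathAlgebra.induction with
      | zero => rw [mul_zero, map_zero, zero_mul]
      | add x x' hx hx' => rw [mul_add, map_add, map_add, add_mul, hx, hx']
      | smul c p =>
        induction y using PathAlgebra.induction with
        | zero => rw [zero_mul, map_zero, mul_zero]
        | add y y' hy hy' => rw [add_mul, map_add, map_add, mul_add, hy, hy']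
        | smul d q =>
          rw [smul_mul_smul_comm, map_smul, map_smul, map_smul, smul_mul_smul_comm, hφ, hφ,
            mul_comm d c, ofPath_mul]
          congr 1
          obtain ⟨a, b, p⟩ := p
          obtain ⟨b', c, q⟩ := q
          by_cases h : c = a
          · subst h
            rw [pathMul_comp, hφ, h_comp]
          · rw [pathMul_ne h, map_zero, h_ne _ _ h] }

theorem PathAlgebra.opLift_smul_ofPath {B : Type*} [Ring B] [Algebra k B] (act : AnyPath V → B)
    (h_one : ∑ v, act ⟨v, v, .nil⟩ = 1)
    (h_comp : ∀ {a b c : V} (p : Path a b) (q : Path b c),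
      act ⟨a, c, p.comp q⟩ = act ⟨b, c, q⟩ * act ⟨a, b, p⟩)
    (h_ne : ∀ p q : AnyPath V, p.2.1 ≠ q.1 → act q * act p = 0) (c : k) (p : AnyPath V) :
    opLift act h_one h_comp h_ne (op (c • ofPath p : PathAlgebra k V)) = c • act p := by
  change Finsupp.linearCombination k act (c • Finsupp.single p (1 : k)) = _
  rw [map_smul, Finsupp.linearCombination_single, one_smul]

/-- An additive map that commutes with the multiples of the paths is linear. -/
def linearMapOfPaths {M N : Type*} [AddCommGroup M] [AddCommGroup N]
    [Module (PathAlgebra k V)ᵐᵒᵖ M] [Module (PathAlgebra k V)ᵐᵒᵖ N] (f : M →+ N)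
    (h : ∀ (c : k) (p : AnyPath V) (m : M),
      f (op (c • ofPath p : PathAlgebra k V) • m) = op (c • ofPath p : PathAlgebra k V) • f m) :
    M →ₗ[(PathAlgebra k V)ᵐᵒᵖ] N where
  toFun := f
  map_add' := map_add f
  map_smul' x m := by
    obtain ⟨x, rfl⟩ := op_surjective x
    induction x using PathAlgebra.induction with
    | zero => simp
    | add x y hx hy =>
      rw [RingHom.id_apply] at hx hy ⊢
      rw [MulOpposite.op_add, add_smul, add_smul, map_add, hx, hy]
    | smul c p => exact h c p m

variable [IsolatedCycles V] (W : Type u) [AddCommGroup W] [Module (CyclicVertex V → k) W]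

variable (k) in
/-- The action of a path on `ℕ →₀ W`: a path that follows a cycle moves the part of `W`
attached to its starting point up by its length, other paths act by zero. -/
def pathAct (p : AnyPath V) : Module.End (CyclicVertex V → k) (ℕ →₀ W) :=
  open Classical in
  if Reachable p.2.1 p.1 then
    Finsupp.lsum (CyclicVertex V → k) fun i =>
      Finsupp.lsingle (i + p.length) ∘ₗ LinearMap.lsmul _ W (orbitIndicator k i p.1)
  else 0

variable {W}

theorem pathAct_single {a b : V} (p : Path a b) (h : Reachable b a) (i : ℕ) (x : W) :
    pathAct k W ⟨a, b, p⟩ (Finsupp.single i x) =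
      Finsupp.single (i + p.length) (orbitIndicator k i a • x) := by
  rw [pathAct, if_pos h, Finsupp.lsum_single]
  rfl

theorem pathAct_of_not_reachable {a b : V} (p : Path a b) (h : ¬ Reachable b a) :
    pathAct k W ⟨a, b, p⟩ = 0 := if_neg h

theorem sum_pathAct : ∑ v : V, pathAct k W ⟨v, v, .nil⟩ = 1 := by
  refine Finsupp.lhom_ext fun i x => ?_
  rw [LinearMap.sum_apply]
  simp only [pathAct_single _ (Reachable.refl _), Quiver.Path.length_nil, add_zero]
  rw [← Finsupp.single_finsetSum, ← Finset.sum_smul, sum_orbitIndicator, one_smul]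
  rfl

/-- The end of a composite leads back to its start exactly when this holds for both factors, so the
two sides vanish together. -/
theorem pathAct_comp {a b c : V} (p : Path a b) (q : Path b c) :
    pathAct k W ⟨a, c, p.comp q⟩ = pathAct k W ⟨b, c, q⟩ * pathAct k W ⟨a, b, p⟩ := by
  by_cases h : Reachable c a
  · have hb : Reachable b a := q.reachable.trans h
    have hc : Reachable c b := h.trans p.reachable
    refine Finsupp.lhom_ext fun i x => ?_
    rw [Module.End.mul_apply, pathAct_single _ h, pathAct_single _ hb, pathAct_single _ hc,
      ← mul_smul, orbitIndicator_mul_of_path p hb, Quiver.Path.length_comp, add_assoc]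
  · rw [pathAct_of_not_reachable _ h]
    by_cases hb : Reachable b a
    · rw [pathAct_of_not_reachable q fun hc => h (hc.trans hb), zero_mul]
    · rw [pathAct_of_not_reachable p hb, mul_zero]

theorem pathAct_mul_of_ne (p q : AnyPath V) (hpq : p.2.1 ≠ q.1) :
    pathAct k W q * pathAct k W p = 0 := by
  obtain ⟨a, b, p⟩ := p
  obtain ⟨c, d, q⟩ := q
  change b ≠ c at hpq
  by_cases hp : Reachable b a
  · by_cases hq : Reachable d c
    · refine Finsupp.lhom_ext fun i x => ?_
      rw [Module.End.mul_apply, pathAct_single _ hp, pathAct_single _ hq, ← mul_smul,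
        orbitIndicator_mul_of_ne p hp i hpq, zero_smul, Finsupp.single_zero]
      rfl
    · rw [pathAct_of_not_reachable q hq, zero_mul]
  · rw [pathAct_of_not_reachable p hp, mul_zero]

variable (k V W) in
/-- The action of the path algebra on `ℕ →₀ W`. -/
def cycleActHom : (PathAlgebra k V)ᵐᵒᵖ →+* Module.End (CyclicVertex V → k) (ℕ →₀ W) :=
  letI : Algebra k (Module.End (CyclicVertex V → k) (ℕ →₀ W)) :=
    Algebra.compHom _ (algebraMap k (CyclicVertex V → k))
  opLift (pathAct k W) sum_pathAct pathAct_comp pathAct_mul_of_ne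

theorem cycleActHom_smul_ofPath (c : k) (p : AnyPath V) (x : ℕ →₀ W) :
    cycleActHom k V W (op (c • ofPath p)) x =
      algebraMap k (CyclicVertex V → k) c • pathAct k W p x := by
  let : Algebra k (Module.End (CyclicVertex V → k) (ℕ →₀ W)) :=
    Algebra.compHom _ (algebraMap k (CyclicVertex V → k))
  exact congrArg (fun f : Module.End (CyclicVertex V → k) (ℕ →₀ W) => f x)
    (opLift_smul_ofPath (pathAct k W) sum_pathAct pathAct_comp pathAct_mul_of_ne c p)

variable (W) in
/-- The elements of `ℕ →₀ W` concentrated in one degree. -/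
def cycleDeg (i : ℤ) : AddSubgroup (ℕ →₀ W) where
  carrier := {f | ∀ j : ℕ, (j : ℤ) ≠ i → f j = 0}
  zero_mem' _ _ := rfl
  add_mem' {f g} hf hg j hj := by rw [Finsupp.add_apply, hf j hj, hg j hj, add_zero]
  neg_mem' {f} hf j hj := by rw [Finsupp.neg_apply, hf j hj, neg_zero]

theorem single_mem_cycleDeg (i : ℕ) (x : W) : Finsupp.single i x ∈ cycleDeg W i := by
  intro j hj
  exact Finsupp.single_eq_of_ne fun h => hj (by rw [h])

theorem eq_single_of_mem_cycleDeg {i : ℕ} {f : ℕ →₀ W} (hf : f ∈ cycleDeg W i) :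
    f = Finsupp.single i (f i) := by
  ext j
  by_cases h : j = i
  · subst h; rw [Finsupp.single_eq_same]
  · rw [Finsupp.single_eq_of_ne h, hf j (by exact_mod_cast h)]

theorem mem_cycleDeg_cases {i : ℤ} {f : ℕ →₀ W} (hf : f ∈ cycleDeg W i) :
    f = 0 ∨ ∃ (j : ℕ) (x : W), (j : ℤ) = i ∧ f = Finsupp.single j x := by
  by_cases hi : 0 ≤ i
  · lift i to ℕ using hi
    exact Or.inr ⟨i, _, rfl, eq_single_of_mem_cycleDeg hf⟩
  · exact Or.inl (Finsupp.ext fun j => hf j (by omega))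

theorem isInternal_cycleDeg : DirectSum.IsInternal (cycleDeg W) :=
  isInternal_of_proj _ (fun i => Finsupp.filterAddHom fun j : ℕ => (j : ℤ) = i)
    (fun i f hf => by
      ext j
      change Finsupp.filter _ f j = _
      by_cases h : (j : ℤ) = i
      · rw [Finsupp.filter_apply_pos (fun j : ℕ => (j : ℤ) = i) _ h]
      · rw [Finsupp.filter_apply_neg (fun j : ℕ => (j : ℤ) = i) _ h, hf j h])
    (fun i i' hi f hf => by
      ext j
      change Finsupp.filter _ f j = _
      by_cases h : (j : ℤ) = i
      · rw [Finsupp.filter_apply_pos (fun j : ℕ => (j : ℤ) = i) _ h, hf j (fun h' => hi (h.symm.trans h'))]; rfl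
      · rw [Finsupp.filter_apply_neg (fun j : ℕ => (j : ℤ) = i) _ h]; rfl)
    (fun f => by
      refine ⟨f.support.map Nat.castEmbedding, fun i => if 0 ≤ i then
        Finsupp.single i.toNat (f i.toNat) else 0, fun i => ?_, ?_⟩
      · dsimp only
        split_ifs with h
        · lift i to ℕ using h
          exact single_mem_cycleDeg _ _
        · exact zero_mem _
      · rw [Finset.sum_map]
        conv_lhs => rw [← Finsupp.sum_single f]
        refine Finset.sum_congr rfl fun n _ => ?_
        simp)

variable (k V W) in
/-- The graded module with a copy of `W` in each nonnegative degree, on which the cycles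
rotate. -/
def cycleModule : GrPath k V where
  carrier := ℕ →₀ W
  module := Module.compHom _ (cycleActHom k V W)
  deg := cycleDeg W
  isInternal := isInternal_cycleDeg
  smul_mem n i a ha m hm := by
    change cycleActHom k V W (op a) m ∈ cycleDeg W (i + n)
    induction ha using Submodule.span_induction with
    | mem a ha =>
      obtain ⟨⟨a, b, p⟩, hp, rfl⟩ := ha
      rw [← one_smul k (ofPath _), cycleActHom_smul_ofPath, map_one, one_smul]
      by_cases h : Reachable b a
      · obtain rfl | ⟨j, x, rfl, rfl⟩ := mem_cycleDeg_cases hm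
        · rw [map_zero]; exact zero_mem _
        · change p.length = n at hp
          rw [pathAct_single _ h, hp, ← Nat.cast_add]
          exact single_mem_cycleDeg (j + n) _
      · rw [pathAct_of_not_reachable _ h]
        exact zero_mem _
    | zero => rw [MulOpposite.op_zero, map_zero]; exact zero_mem _
    | add x y _ _ hx hy => rw [MulOpposite.op_add, map_add]; exact add_mem hx hy
    | smul c x _ hx =>
      -- The action is only a ring homomorphism here, so the scalar is isolated as the element `c •
      -- 1`, which acts coefficientwise and preserves degrees.
      have h : c • x = x * c • (1 : PathAlgebra k V) := by rw [mul_smul_comm, mul_one]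
      have hc : ∀ y : ℕ →₀ W, cycleActHom k V W (op (c • (1 : PathAlgebra k V))) y =
          algebraMap k (CyclicVertex V → k) c • y := by
        intro y
        rw [one_def, Finset.smul_sum, Finset.op_sum, map_sum, LinearMap.sum_apply]
        simp only [cycleActHom_smul_ofPath]
        rw [← Finset.smul_sum, ← LinearMap.sum_apply, sum_pathAct]
        rfl
      rw [h, op_mul, map_mul, Module.End.mul_apply, hc]
      intro j hj
      rw [Finsupp.smul_apply, hx j hj, smul_zero]

variable (k V W) in
/-- The element of degree `i` attached to an element of `W`. -/
def cycleElt (i : ℕ) : W →+ cycleModule k V W := Finsupp.singleAddHom i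

theorem cycleElt_mem_deg (i : ℕ) (x : W) : cycleElt k V W i x ∈ (cycleModule k V W).deg i :=
  single_mem_cycleDeg i x

theorem cycleElt_injective (i : ℕ) : Function.Injective (cycleElt k V W i) :=
  Finsupp.single_injective i

theorem exists_eq_cycleElt {i : ℕ} {m : cycleModule k V W} (hm : m ∈ (cycleModule k V W).deg i) :
    ∃ x, m = cycleElt k V W i x :=
  ⟨_, eq_single_of_mem_cycleDeg hm⟩

theorem cycleModule_induction {motive : cycleModule k V W → Prop} (m : cycleModule k V W)
    (zero : motive 0) (add : ∀ x y, motive x → motive y → motive (x + y))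
    (elt : ∀ i x, motive (cycleElt k V W i x)) : motive m :=
  Finsupp.induction_linear (motive := motive) m zero add elt

theorem smul_ofPath_cycleElt (c : k) {a b : V} (p : Path a b) (h : Reachable b a) (i : ℕ) (x : W) :
    op (c • ofPath ⟨a, b, p⟩ : PathAlgebra k V) • cycleElt k V W i x =
      cycleElt k V W (i + p.length)
        ((algebraMap k (CyclicVertex V → k) c * orbitIndicator k i a) • x) := by
  refine (cycleActHom_smul_ofPath c _ _).trans ?_
  change _ • pathAct k W _ (Finsupp.single i x) = _
  rw [pathAct_single p h, Finsupp.smul_single, ← mul_smul]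
  rfl

theorem smul_ofPath_cycleModule (c : k) {a b : V} (p : Path a b) (h : ¬ Reachable b a)
    (m : cycleModule k V W) : op (c • ofPath ⟨a, b, p⟩ : PathAlgebra k V) • m = 0 := by
  refine (cycleActHom_smul_ofPath c _ _).trans ?_
  rw [pathAct_of_not_reachable p h]
  exact smul_zero (A := ℕ →₀ W) _

/-- In degree `j` the idempotent at the `j`-th rotate of `v` acts as the coordinate `v`. The two
rotations cancel and the original action on `W` reappears. -/
theorem twist_smul_cycleElt (j : ℕ) (c : CyclicVertex V → k) (x : W) :
    op (twist k j c) • cycleElt k V W j x = cycleElt k V W j (c • x) := by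
  classical
  rw [twist_apply, Finset.op_sum, Finset.sum_smul]
  have h : ∀ v : CyclicVertex V, op (c v • vertexIdem k ((cycleRot V ^ j) v).1) •
      cycleElt k V W j x = cycleElt k V W j ((Pi.single v (c v) : CyclicVertex V → k) • x) := by
    intro v
    refine (smul_ofPath_cycleElt (c v) .nil (.refl _) j x).trans ?_
    rw [orbitIndicator_cycleRot_pow, Quiver.Path.length_nil, add_zero]
    congr 2
    funext w
    by_cases hw : w = v
    · subst hw; simp
    · simp [hw]
  rw [Finset.sum_congr rfl fun v _ => h v, ← map_sum, ← Finset.sum_smul,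
    Finset.univ_sum_single]

/-- Each cyclic arrow moves one coordinate of `x` up a degree, and the coordinate idempotents add up
to 1. -/
theorem cycleStep_smul_cycleElt (j : ℕ) (x : W) :
    op (cycleStep k V) • cycleElt k V W j x = cycleElt k V W (j + 1) x := by
  classical
  rw [cycleStep, Finset.op_sum, Finset.sum_smul]
  have h : ∀ v : CyclicVertex V, op (ofPath ⟨v.1, (cycleRot V v).1, (nextHom v).toPath⟩ :
      PathAlgebra k V) • cycleElt k V W j x =
      cycleElt k V W (j + 1) (orbitIndicator k j v.1 • x) := by
    intro v
    have := smul_ofPath_cycleElt (k := k) (W := W) 1 (nextHom v).toPath (reachable_cycleRot v) j x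
    rwa [one_smul, map_one, one_mul] at this
  rw [Finset.sum_congr rfl fun v _ => h v, ← map_sum, ← Finset.sum_smul,
    ← Equiv.sum_comp (cycleRot V ^ j)]
  simp only [orbitIndicator_cycleRot_pow]
  rw [show ∑ v : CyclicVertex V, (Pi.single v 1 : CyclicVertex V → k) = 1 from
    Finset.univ_sum_single (1 : CyclicVertex V → k), one_smul]

variable {W' : Type u} [AddCommGroup W'] [Module (CyclicVertex V → k) W']

/-- The additive map induced on the modules spread along the cycles. -/
def cycleModuleAddHom (f : W →ₗ[CyclicVertex V → k] W') :
    cycleModule k V W →+ cycleModule k V W' :=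
  Finsupp.mapRange.addMonoidHom f.toAddMonoidHom

theorem cycleModuleAddHom_cycleElt (f : W →ₗ[CyclicVertex V → k] W') (i : ℕ) (x : W) :
    cycleModuleAddHom f (cycleElt k V W i x) = cycleElt k V W' i (f x) :=
  Finsupp.mapRange_single (hf := map_zero f)

/-- The map of graded modules induced by a linear map. -/
def cycleModuleMap (f : W →ₗ[CyclicVertex V → k] W') : cycleModule k V W ⟶ cycleModule k V W' where
  lin := linearMapOfPaths (cycleModuleAddHom f) fun c p m => by
    obtain ⟨a, b, p⟩ := p
    by_cases h : Reachable b a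
    · induction m using cycleModule_induction with
      | zero => rw [smul_zero, map_zero, smul_zero]
      | add x y hx hy => rw [smul_add, map_add, map_add, smul_add, hx, hy]
      | elt i x =>
        rw [smul_ofPath_cycleElt c p h, cycleModuleAddHom_cycleElt, cycleModuleAddHom_cycleElt,
          smul_ofPath_cycleElt c p h, map_smul]
    · rw [smul_ofPath_cycleModule c p h, smul_ofPath_cycleModule c p h, map_zero]
  map_mem i m hm j hj := by
    exact (congrArg f (hm j hj)).trans (map_zero f)

theorem cycleModuleMap_cycleElt (f : W →ₗ[CyclicVertex V → k] W') (i : ℕ) (x : W) :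
    (cycleModuleMap f).lin (cycleElt k V W i x) = cycleElt k V W' i (f x) :=
  Finsupp.mapRange_single (hf := map_zero f)

theorem cycleModule_hom_ext {M : GrPath k V} {f g : cycleModule k V W ⟶ M}
    (h : ∀ i x, f.lin (cycleElt k V W i x) = g.lin (cycleElt k V W i x)) : f = g :=
  GrMod.hom_ext fun m => by
    induction m using cycleModule_induction with
    | zero => rw [map_zero, map_zero]
    | add x y hx hy => rw [map_add, map_add, hx, hy]
    | elt i x => exact h i x

variable (k V) in
/-- The functor that spreads a module along the cycles. -/
def cycleFunctor : ModuleCat.{u} (CyclicVertex V → k) ⥤ GrPath k V where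
  obj W := cycleModule k V W
  map f := cycleModuleMap f.hom
  map_id W := cycleModule_hom_ext fun i x => cycleModuleMap_cycleElt _ i x
  map_comp f g := cycleModule_hom_ext fun i x => by
    rw [cycleModuleMap_cycleElt, GrMod.comp_lin, cycleModuleMap_cycleElt, cycleModuleMap_cycleElt]
    rfl

variable (k V W) in
/-- The constant sequences in the module spread along the cycles. -/
def constSeq : W →ₗ[CyclicVertex V → k] orbitSeq (cycleModule k V W) where
  toFun x := ⟨fun j => cycleElt k V W j x, fun j => ⟨cycleElt_mem_deg j x, by
    rw [twist_smul_cycleElt, one_smul]⟩, 0, fun j _ => (cycleStep_smul_cycleElt j x).symm⟩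
  map_add' x y := orbitSeq_ext fun j => map_add (cycleElt k V W j) x y
  map_smul' c x := orbitSeq_ext fun j => (twist_smul_cycleElt j c x).symm

variable (k V W) in
/-- A module is recovered as the limit along the cycles of the module spread along them. -/
def orbitLimitCycleModule : W ≃ₗ[CyclicVertex V → k] OrbitLimit (cycleModule k V W) :=
  LinearEquiv.ofBijective ((orbitNull (cycleModule k V W)).mkQ ∘ₗ constSeq k V W) (by
    constructor
    · rw [injective_iff_map_eq_zero]
      intro x hx
      obtain ⟨N, hN⟩ := (Submodule.Quotient.mk_eq_zero _).1 hx
      exact cycleElt_injective N ((hN N le_rfl).trans (map_zero _).symm)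
    · intro s
      obtain ⟨s, rfl⟩ := (orbitNull (cycleModule k V W)).mkQ_surjective s
      obtain ⟨N, hN⟩ := s.2.2
      obtain ⟨x, hx⟩ := exists_eq_cycleElt (s.2.1 N).1
      -- From degree `N` on the sequence is determined by its term there, because a step carries `x`
      -- to the copy of `x` one degree higher.
      refine ⟨x, mkQ_eq_of_eventually N fun j hj => ?_⟩
      change cycleElt k V W j x = s.1 j
      induction j, hj using Nat.le_induction with
      | base => exact hx.symm
      | succ j hj ih => rw [hN j hj, ← ih, cycleStep_smul_cycleElt])

theorem orbitLimitMap_cycleModuleMap (f : W →ₗ[CyclicVertex V → k] W') (x : W) :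
    orbitLimitMap (cycleModuleMap f) (orbitLimitCycleModule k V W x) =
      orbitLimitCycleModule k V W' (f x) :=
  congrArg (orbitNull (cycleModule k V W')).mkQ
    (orbitSeq_ext fun j => cycleModuleMap_cycleElt f j x)

variable (k V) in
/-- Spreading along the cycles is a section of the limit along the cycles. -/
def cycleOrbitIso : cycleFunctor k V ⋙ orbitFunctor k V ≅ 𝟭 _ :=
  (NatIso.ofComponents (F := 𝟭 _) (G := cycleFunctor k V ⋙ orbitFunctor k V)
    (fun W => (orbitLimitCycleModule k V W).toModuleIso) (by
    intro W W' f
    refine ModuleCat.hom_ext (LinearMap.ext fun x => ?_)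
    exact (orbitLimitMap_cycleModuleMap f.hom x).symm)).symm

end CycleModule

/-! ### Comparison of a graded module with its limit along the cycles -/

/-- Naturality of the isomorphism given by a span of isomorphisms. -/
theorem comp_span_iso {C : Type*} [Category C] {A B D A' B' D' : C} (i : D ≅ A) (t : D ≅ B)
    (i' : D' ≅ A') (t' : D' ≅ B') (f : A ⟶ A') (g : B ⟶ B') (d : D ⟶ D')
    (hi : d ≫ i'.hom = i.hom ≫ f) (ht : d ≫ t'.hom = t.hom ≫ g) :
    f ≫ (i'.symm ≪≫ t').hom = (i.symm ≪≫ t).hom ≫ g := by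
  rw [← cancel_epi i.hom, ← Category.assoc, ← hi]
  simp [ht]

/-! ### Transient vertices -/

section Transient

open Quiver (Path Reachable)

variable {V : Type u} [Quiver.{u} V]

/-- A vertex is transient if it is not cyclic but leads to a cyclic vertex. -/
def IsTransient (a : V) : Prop :=
  ¬ IsCyclicVertex a ∧ ∃ c, IsCyclicVertex c ∧ Reachable a c

variable [IsolatedCycles V]

/-- If `b` were cyclic, the route from `b` through `a` to a cyclic vertex could be reversed, which
would put `a` on a closed path. -/
theorem IsTransient.of_reachable {a b : V} (ha : IsTransient a) (h : Reachable b a) :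
    IsTransient b := by
  obtain ⟨ha, c, hc, hac⟩ := ha
  refine ⟨fun hb => ha ?_, c, hc, h.trans hac⟩
  exact hb.of_reachable h (hac.trans (IsolatedCycles.reachable_symm hb hc (h.trans hac)))

/-- A longer path would contain a closed piece, hence a cyclic vertex leading to `a`, whereas all
predecessors of a transient vertex are transient. -/
theorem IsTransient.length_lt [Fintype V] {a b : V} (ha : IsTransient a) (p : Path b a) :
    p.length < Fintype.card V := by
  by_contra! hp
  obtain ⟨c, p₁, p₂, p₃, rfl, h⟩ := p.exists_comp_of_card_le hp
  exact (ha.of_reachable p₃.reachable).1 (isCyclicVertex_iff.2 ⟨p₂, h⟩)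

end Transient

/-! ### The core of a graded module and its map to the spread-out colimit -/

section Core

open Quiver (Path Reachable)
open PathAlgebra

variable {k : Type u} [Field k] {V : Type u} [Quiver.{u} V] [Fintype V]

theorem smul_mem_of_paths {M : Type*} [AddCommGroup M] [Module (PathAlgebra k V)ᵐᵒᵖ M]
    (S : Submodule (PathAlgebra k V)ᵐᵒᵖ M) {m : M} {n : ℕ}
    (h : ∀ {a b : V} (p : Path a b), p.length = n →
      op (ofPath ⟨a, b, p⟩ : PathAlgebra k V) • m ∈ S) {x : PathAlgebra k V}
    (hx : x ∈ grade k V n) : op x • m ∈ S := by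
  induction hx using Submodule.span_induction with
  | mem x hx =>
    obtain ⟨⟨a, b, p⟩, hp, rfl⟩ := hx
    exact h p hp
  | zero => rw [MulOpposite.op_zero, zero_smul]; exact zero_mem _
  | add x y _ _ hx hy => rw [MulOpposite.op_add, add_smul]; exact add_mem hx hy
  | smul c x _ hx =>
    rw [← mul_one x, ← mul_smul_comm, op_mul, mul_smul]
    exact Submodule.smul_mem _ _ hx

theorem GrMod.proj_smul_zero {M : GrPath k V} {a : PathAlgebra k V} (ha : a ∈ grade k V 0) (i : ℤ)
    (m : M) : M.proj i (op a • m) = op a • M.proj i m := by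
  have := GrMod.proj_smul (M := M) ha i m
  rwa [Nat.cast_zero, sub_zero] at this

theorem GrMod.exists_finset_proj (M : GrPath k V) (m : M) :
    ∃ s : Finset ℤ, m = ∑ i ∈ s, M.proj i m ∧ ∀ i ∉ s, M.proj i m = 0 := by
  obtain ⟨s, hs⟩ := M.exists_sum_proj m
  refine ⟨s, hs, fun i hi => ?_⟩
  rw [hs, map_sum]
  exact Finset.sum_eq_zero fun j hj =>
    GrMod.proj_ne (fun h : i = j => hi (by rwa [h])) (GrMod.proj_mem j m)

variable [IsolatedCycles V]

theorem vertexIdem_mul_twist_one {a : V} (ha : ¬ IsCyclicVertex a) (j : ℕ) :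
    vertexIdem k a * twist k j 1 = 0 := by
  rw [twist_one, Finset.mul_sum]
  refine Finset.sum_eq_zero fun v _ => vertexIdem_mul_of_ne k fun h => ha ?_
  rw [h]
  exact v.2

theorem twist_one_mul_vertexIdem {a : V} (ha : ¬ IsCyclicVertex a) (j : ℕ) :
    twist k j 1 * vertexIdem k a = 0 := by
  rw [twist_one, Finset.sum_mul]
  refine Finset.sum_eq_zero fun v _ => vertexIdem_mul_of_ne k fun h => ha ?_
  rw [← h]
  exact v.2

/-- The elements of nonnegative degree without components at transient vertices. -/
def coreSubmodule (M : GrPath k V) : Submodule (PathAlgebra k V)ᵐᵒᵖ M where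
  carrier := {m | (∀ i < 0, M.proj i m = 0) ∧ ∀ a : V, IsTransient a → op (vertexIdem k a) • m = 0}
  zero_mem' := ⟨fun _ _ => map_zero _, fun _ _ => smul_zero _⟩
  add_mem' {m m'} h h' := ⟨fun i hi => by rw [map_add, h.1 i hi, h'.1 i hi, add_zero],
    fun a ha => by rw [smul_add, h.2 a ha, h'.2 a ha, add_zero]⟩
  smul_mem' x m h := by
    obtain ⟨x, rfl⟩ := op_surjective x
    induction x using PathAlgebra.induction with
    | zero =>
      rw [MulOpposite.op_zero, zero_smul]
      exact ⟨fun _ _ => map_zero _, fun _ _ => smul_zero _⟩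
    | add x y hx hy =>
      rw [MulOpposite.op_add, add_smul]
      exact ⟨fun i hi => by rw [map_add, hx.1 i hi, hy.1 i hi, add_zero],
        fun a ha => by rw [smul_add, hx.2 a ha, hy.2 a ha, add_zero]⟩
    | smul c p =>
      obtain ⟨a, b, p⟩ := p
      constructor
      · intro i hi
        have hp : c • ofPath ⟨a, b, p⟩ ∈ grade k V p.length :=
          Submodule.smul_mem _ _ (ofPath_mem_grade (⟨a, b, p⟩ : AnyPath V))
        rw [GrMod.proj_smul hp, h.1 _ (by omega), smul_zero]
      · intro d hd
        rw [← mul_smul, ← op_mul, smul_mul_assoc]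
        -- A path that ends at a transient vertex also starts at one, where `m` has no component.
        by_cases hb : b = d
        · subst hb
          rw [ofPath_mul_vertexIdem, ← vertexIdem_mul_ofPath, ← mul_smul_comm, op_mul, mul_smul,
            h.2 a (hd.of_reachable p.reachable), smul_zero]
        · rw [ofPath_mul_vertexIdem_of_ne k p hb, smul_zero, MulOpposite.op_zero, zero_smul]

theorem isHomog_coreSubmodule (M : GrPath k V) : M.IsHomog (coreSubmodule M) := by
  refine fun i m h => ⟨fun j hj => ?_, fun a ha => ?_⟩
  · by_cases hij : j = i
    · subst hij; rw [h.1 j hj, map_zero]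
    · exact GrMod.proj_ne hij (GrMod.proj_mem i m)
  · rw [← GrMod.proj_smul_zero (vertexIdem_mem_grade k a), h.2 a ha, map_zero]

/-- The graded submodule of elements of nonnegative degree without components at transient
vertices. -/
def coreModule (M : GrPath k V) : GrPath k V := M.sub (coreSubmodule M) (isHomog_coreSubmodule M)

/-- The inclusion of the core. -/
def coreι (M : GrPath k V) : coreModule M ⟶ M := M.subι _ (isHomog_coreSubmodule M)

variable {M N : GrPath k V}

/-- The map induced on the cores. -/
def coreMap (f : M ⟶ N) : coreModule M ⟶ coreModule N where
  lin := f.lin.restrict (p := coreSubmodule M) (q := coreSubmodule N) fun m hm =>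
    ⟨fun i hi => by rw [← GrMod.hom_proj, hm.1 i hi, map_zero],
      fun a ha => by rw [← map_smul, hm.2 a ha, map_zero]⟩
  map_mem i m hm := f.map_mem i m.1 hm

theorem coreMap_coreι (f : M ⟶ N) : coreMap f ≫ coreι N = coreι M ≫ f := rfl

theorem germ_smul_vertexIdem {b : V} (hb : ¬ IsCyclicVertex b) (j : ℕ) (m : M) :
    germ M j (op (vertexIdem k b) • m) = 0 := by
  rw [germ_eq_zero_iff]
  refine ⟨0, ?_⟩
  rw [pow_zero, mul_one, GrMod.proj_smul_zero (vertexIdem_mem_grade k b), ← mul_smul, ← op_mul,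
    vertexIdem_mul_twist_one hb, MulOpposite.op_zero, zero_smul]

theorem germ_smul_ofPath_of_not_cyclic {a b : V} (p : Path a b) (hb : ¬ IsCyclicVertex b) (c : k)
    (j : ℕ) (m : M) : germ M j (op (c • ofPath ⟨a, b, p⟩ : PathAlgebra k V) • m) = 0 := by
  rw [← ofPath_mul_vertexIdem, ← smul_mul_assoc, op_mul, mul_smul, germ_smul_vertexIdem hb]

theorem germ_smul_ofPath (m : M) {a b : V} (p : Path a b) (h : Reachable b a) (c : k) (j : ℕ) :
    germ M (j + p.length) (op (c • ofPath ⟨a, b, p⟩ : PathAlgebra k V) • m) =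
      (algebraMap k (CyclicVertex V → k) c * orbitIndicator k j a) • germ M j m := by
  by_cases ha : IsCyclicVertex a
  · have hp := ofPath_eq_vertexIdem_mul (k := k) ⟨a, ha⟩ p h
    dsimp only at hp
    rw [hp, ← smul_mul_assoc, op_mul, mul_smul, germ_cycleStep_pow, smul_germ,
      ← Algebra.smul_def, LinearMap.map_smul, twist_orbitIndicator j ha]
  · rw [orbitIndicator_of_not_cyclic j ha, mul_zero, zero_smul]
    by_cases hb : IsCyclicVertex b
    · exact absurd (hb.of_reachable h p.reachable) ha
    · exact germ_smul_ofPath_of_not_cyclic p hb c _ m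

/-- This is the reason for the core. A path that cannot be undone acts by zero on the spread-out
module, but in `M` it may carry a component into a cyclic vertex. Its start is then transient, and
the core has no component there. -/
theorem germ_smul_ofPath_of_not_reachable {m : M} (hm : m ∈ coreSubmodule M) {a b : V}
    (p : Path a b) (h : ¬ Reachable b a) (c : k) (j : ℕ) :
    germ M j (op (c • ofPath ⟨a, b, p⟩ : PathAlgebra k V) • m) = 0 := by
  by_cases hb : IsCyclicVertex b
  · have ha : IsTransient a :=
      ⟨fun ha => h (IsolatedCycles.reachable_symm ha hb p.reachable), b, hb, p.reachable⟩
    rw [← vertexIdem_mul_ofPath, ← mul_smul_comm, op_mul, mul_smul, hm.2 a ha, smul_zero, map_zero]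
  · exact germ_smul_ofPath_of_not_cyclic p hb c _ m

theorem finite_germ_ne_zero (m : M) : (Function.support fun j : ℕ => germ M j m).Finite := by
  obtain ⟨s, _, hs⟩ := M.exists_finset_proj m
  refine (s.finite_toSet.preimage (Nat.cast_injective (R := ℤ)).injOn).subset fun j hj => ?_
  by_contra h
  exact hj (by dsimp only; rw [← germ_proj, hs j h, map_zero])

variable (M) in
/-- The components of an element in the limit along the cycles. -/
def germSum : M →+ cycleModule k V (OrbitLimit M) where
  toFun m := Finsupp.ofSupportFinite _ (finite_germ_ne_zero m)
  map_zero' := Finsupp.ext fun j => map_zero (germ M j)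
  map_add' m m' := Finsupp.ext fun j => map_add (germ M j) m m'

theorem germSum_of_mem_deg {j : ℕ} {m : M} (hm : m ∈ M.deg j) :
    germSum M m = cycleElt k V _ j (germ M j m) := by
  refine Finsupp.ext fun i => ?_
  change germ M i m = Finsupp.single j (germ M j m) i
  by_cases h : i = j
  · subst h; rw [Finsupp.single_eq_same]
  · rw [Finsupp.single_eq_of_ne h, ← germ_proj, GrMod.proj_ne (by exact_mod_cast h) hm, map_zero]

theorem germ_eq_zero_of_germSum {m : M} (h : germSum M m = 0) (j : ℕ) : germ M j m = 0 :=
  congrArg (fun f : ℕ →₀ OrbitLimit M => f j) h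

theorem germSum_smul {m : M} (hm : m ∈ coreSubmodule M) (c : k) (p : AnyPath V) :
    germSum M (op (c • ofPath p : PathAlgebra k V) • m) =
      op (c • ofPath p : PathAlgebra k V) • germSum M m := by
  obtain ⟨a, b, p⟩ := p
  obtain ⟨s, hs⟩ := M.exists_sum_proj m
  have key : ∀ i : ℤ, germSum M (op (c • ofPath ⟨a, b, p⟩ : PathAlgebra k V) • M.proj i m) =
      op (c • ofPath ⟨a, b, p⟩ : PathAlgebra k V) • germSum M (M.proj i m) := by
    intro i
    by_cases hi : i < 0
    · rw [hm.1 i hi, smul_zero, map_zero, smul_zero]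
    · lift i to ℕ using not_lt.1 hi
      have hp : c • ofPath ⟨a, b, p⟩ ∈ grade k V p.length :=
        Submodule.smul_mem _ _ (ofPath_mem_grade (⟨a, b, p⟩ : AnyPath V))
      have h1 := M.smul_mem _ _ _ hp _ (GrMod.proj_mem (i : ℤ) m)
      rw [← Nat.cast_add] at h1
      have h2 := isHomog_coreSubmodule M i m hm
      rw [germSum_of_mem_deg h1, germSum_of_mem_deg (GrMod.proj_mem (i : ℤ) m)]
      by_cases h : Reachable b a
      · rw [germ_smul_ofPath _ p h, smul_ofPath_cycleElt c p h]
      · rw [germ_smul_ofPath_of_not_reachable h2 p h, smul_ofPath_cycleModule c p h, map_zero]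
  rw [hs, Finset.smul_sum, map_sum, map_sum, Finset.smul_sum]
  exact Finset.sum_congr rfl fun i _ => key i

variable (M) in
/-- The map from the core to the module spread along the cycles. -/
def coreτ : coreModule M ⟶ cycleModule k V (OrbitLimit M) where
  lin := linearMapOfPaths ((germSum M).comp (coreSubmodule M).subtype.toAddMonoidHom)
    fun c p m => germSum_smul m.2 c p
  map_mem i m hm := by
    by_cases hi : i < 0
    · have h0 : m.1 = 0 := (GrMod.proj_same (M := M) hm).symm.trans (m.2.1 i hi)
      change germSum M m.1 ∈ _
      rw [h0, map_zero]
      exact zero_mem _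
    · lift i to ℕ using not_lt.1 hi
      have h := germSum_of_mem_deg (M := M) (m := m.1) hm
      change germSum M m.1 ∈ _
      rw [h]
      exact cycleElt_mem_deg _ _

theorem coreMap_coreτ (f : M ⟶ N) :
    coreMap f ≫ coreτ N = coreτ M ≫ cycleModuleMap (orbitLimitMap f) := by
  refine GrMod.hom_ext fun m => Finsupp.ext fun j => ?_
  exact (orbitLimitMap_germ f j m.1).symm

theorem exists_cycleStep_pow_smul_eq_zero {m : M} (hm : m ∈ coreSubmodule M)
    (h : germSum M m = 0) : ∃ J : ℕ, op (cycleStep k V ^ J) • m = 0 := by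
  have key : ∀ i : ℤ, ∃ l : ℕ, op (cycleStep k V ^ l) • M.proj i m = 0 := by
    intro i
    by_cases hi : i < 0
    · exact ⟨0, by rw [hm.1 i hi, smul_zero]⟩
    · lift i to ℕ using not_lt.1 hi
      obtain ⟨l, hl⟩ := germ_eq_zero_iff.1 (germ_eq_zero_of_germSum h i)
      -- `m` need not be supported at cyclic vertices. One more step absorbs the projection to them,
      -- since a step begins at a cyclic vertex.
      refine ⟨l + 1, ?_⟩
      have : cycleStep k V ^ (l + 1) = twist k i 1 * cycleStep k V ^ l * cycleStep k V := by
        rw [mul_assoc, ← pow_succ, pow_succ', ← mul_assoc, twist_one_mul_cycleStep]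
      rw [this, op_mul, mul_smul, hl, smul_zero]
  choose l hl using key
  obtain ⟨s, hs⟩ := M.exists_sum_proj m
  refine ⟨s.sup l, ?_⟩
  rw [hs, Finset.smul_sum]
  refine Finset.sum_eq_zero fun i hi => ?_
  obtain ⟨d, hd⟩ := Nat.exists_eq_add_of_le (Finset.le_sup (f := l) hi)
  rw [hd, pow_add, op_mul, mul_smul, hl, smul_zero]

/-- Past its first `J` arrows the path still contains a closed piece, so its start leads to a cyclic
vertex. Either the start is transient and `m` vanishes there, or it is cyclic; then the first `J`
arrows follow the cycle and act through `cycleStep ^ J`. -/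
theorem smul_ofPath_eq_zero {m : M} (hm : m ∈ coreSubmodule M) {J : ℕ}
    (hJ : op (cycleStep k V ^ J) • m = 0) {a b : V} (p : Path a b)
    (hp : J + Fintype.card V ≤ p.length) :
    op (ofPath ⟨a, b, p⟩ : PathAlgebra k V) • m = 0 := by
  by_cases ha : IsTransient a
  · rw [← vertexIdem_mul_ofPath, op_mul, mul_smul, hm.2 a ha, smul_zero]
  obtain ⟨d, p₁, p₂, rfl, h1⟩ := p.exists_eq_comp_of_le_length (n := J) (by omega)
  rw [Quiver.Path.length_comp] at hp
  obtain ⟨c, q₁, q₂, q₃, rfl, hq⟩ := p₂.exists_comp_of_card_le (by omega)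
  have hc : IsCyclicVertex c := isCyclicVertex_iff.2 ⟨q₂, hq⟩
  have hac : Reachable a c := p₁.reachable.trans q₁.reachable
  have ha' : IsCyclicVertex a := by
    by_contra h
    exact ha ⟨h, c, hc, hac⟩
  have hda : Reachable d a := q₁.reachable.trans (IsolatedCycles.reachable_symm ha' hc hac)
  have hp₁ := ofPath_eq_mul_vertexIdem (k := k) ⟨a, ha'⟩ p₁ hda
  dsimp only at hp₁
  rw [ofPath_comp, hp₁, h1, op_mul, op_mul, mul_smul, mul_smul, hJ, smul_zero, smul_zero]

variable [∀ a b : V, Finite (a ⟶ b)]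

variable (M) in
-- A long path raises all the degrees that occur in `m` to nonnegative ones and is too long to end
-- at a transient vertex, so it carries `m` into the core.
theorem isoModSerre_coreι :
    (GrMod.tors (grade k V) : ObjectProperty (GrPath k V)).isoModSerre (coreι M) := by
  rw [isoModSerre_iff_elements]
  refine ⟨fun m hm => ⟨0, fun i _ a _ => ?_⟩, fun m => ?_⟩
  · have h0 : m = 0 := Subtype.ext hm
    rw [h0, smul_zero]
  · obtain ⟨s, _, hs⟩ := M.exists_finset_proj m
    obtain ⟨D, hD⟩ := (s.finite_toSet.image Int.natAbs).bddAbove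
    refine ⟨max (Fintype.card V) (D + 1), fun i hi x hx => ?_⟩
    have hr : LinearMap.range (coreι M).lin = coreSubmodule M := Submodule.range_subtype _
    rw [hr]
    refine smul_mem_of_paths (coreSubmodule M)
      (fun {a b} p hp => ⟨fun j hj => ?_, fun d hd => ?_⟩) hx
    · have hp' : ofPath ⟨a, b, p⟩ ∈ grade k V p.length :=
        ofPath_mem_grade (⟨a, b, p⟩ : AnyPath V)
      rw [GrMod.proj_smul hp', hs, smul_zero]
      intro hmem
      have := hD ⟨_, hmem, rfl⟩
      omega
    · by_cases hb : b = d
      · subst hb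
        have := hd.length_lt p
        omega
      · rw [← mul_smul, ← op_mul, ofPath_mul_vertexIdem_of_ne k p hb, MulOpposite.op_zero,
          zero_smul]

variable (M) in
theorem isoModSerre_coreτ :
    (GrMod.tors (grade k V) : ObjectProperty (GrPath k V)).isoModSerre (coreτ M) := by
  rw [isoModSerre_iff_elements]
  refine ⟨fun m hm => ?_, fun y => ?_⟩
  · obtain ⟨J, hJ⟩ := exists_cycleStep_pow_smul_eq_zero m.2 hm
    refine ⟨J + Fintype.card V, fun i hi a ha => Subtype.ext ?_⟩
    refine (Submodule.mem_bot (PathAlgebra k V)ᵐᵒᵖ).1 (smul_mem_of_paths ⊥ (fun p hp => ?_) ha)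
    exact (Submodule.mem_bot _).2 (smul_ofPath_eq_zero m.2 hJ p (by omega))
  · induction y using cycleModule_induction with
    | zero => exact ⟨0, fun i _ a _ => by rw [smul_zero]; exact zero_mem _⟩
    | add x y hx hy =>
      obtain ⟨n, hn⟩ := hx
      obtain ⟨n', hn'⟩ := hy
      refine ⟨max n n', fun i hi a ha => ?_⟩
      rw [smul_add]
      exact add_mem (hn i (le_trans (le_max_left _ _) hi) a ha)
        (hn' i (le_trans (le_max_right _ _) hi) a ha)
    | elt i w =>
      obtain ⟨n, hn⟩ := exists_germ_eq w
      refine ⟨n, fun l hl x hx => smul_mem_of_paths _ (fun {a b} p hp => ?_) hx⟩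
      rw [← one_smul k (ofPath _)]
      by_cases h : Reachable b a
      -- A long path puts its value in a degree large enough for `w` to have a representative there.
      -- That representative is fixed by the projection to the cyclic vertices, hence lies in the
      -- core after twisting.
      · obtain ⟨m, hm, he, rfl⟩ := hn (i + p.length) (by omega)
        rw [smul_ofPath_cycleElt 1 p h, smul_germ]
        set c := algebraMap k (CyclicVertex V → k) 1 * orbitIndicator k i a
        have hdeg := smul_mem_deg_zero (twist_mem_grade (i + p.length) c) hm
        have hmem : op (twist k (i + p.length) c) • m ∈ coreSubmodule M := by
          refine Submodule.smul_mem _ _ ⟨fun j hj => GrMod.proj_ne (by omega) hm, fun d hd => ?_⟩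
          rw [← he, ← mul_smul, ← op_mul, twist_one_mul_vertexIdem hd.1, MulOpposite.op_zero,
            zero_smul]
        exact ⟨⟨_, hmem⟩, germSum_of_mem_deg hdeg⟩
      · rw [smul_ofPath_cycleModule 1 p h]
        exact zero_mem _

variable (k V) in
/-- In the quotient category, every graded module is recovered from its limit along the
cycles. -/
def quotientIso : QGr.quotient k V ≅ orbitFunctor k V ⋙ cycleFunctor k V ⋙ QGr.quotient k V :=
  NatIso.ofComponents (fun M =>
    (Localization.isoOfHom (QGr.quotient k V) _ (coreι M) (isoModSerre_coreι M)).symm ≪≫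
      Localization.isoOfHom (QGr.quotient k V) _ (coreτ M) (isoModSerre_coreτ M)) (by
    intro M N f
    refine comp_span_iso _ _ _ _ _ _ ((QGr.quotient k V).map (coreMap f)) ?_ ?_
    · exact ((QGr.quotient k V).map_comp _ _).symm.trans
        ((congrArg (QGr.quotient k V).map (coreMap_coreι f)).trans
          ((QGr.quotient k V).map_comp _ _))
    · exact ((QGr.quotient k V).map_comp _ _).symm.trans
        ((congrArg (QGr.quotient k V).map (coreMap_coreτ f)).trans
          ((QGr.quotient k V).map_comp _ _)))

end Core

/-! ### The equivalence -/

section Equivalence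

open PathAlgebra

variable (k : Type u) [Field k] (V : Type u) [Quiver.{u} V] [Fintype V] [IsolatedCycles V]
  [∀ a b : V, Finite (a ⟶ b)]

/-- The limit along the cycles as a functor on the quotient category. -/
def qgrOrbitFunctor : QGr k V ⥤ ModuleCat.{u} (CyclicVertex V → k) :=
  Localization.lift (orbitFunctor k V) orbitFunctor_inverts (QGr.quotient k V)

/-- The limit along the cycles factors through the quotient category. -/
def quotientCompOrbitIso : QGr.quotient k V ⋙ qgrOrbitFunctor k V ≅ orbitFunctor k V :=
  Localization.fac (orbitFunctor k V) orbitFunctor_inverts (QGr.quotient k V)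

instance : Localization.Lifting (QGr.quotient k V)
    (GrMod.tors (grade k V) : ObjectProperty (GrPath k V)).isoModSerre
    (orbitFunctor k V) (qgrOrbitFunctor k V) :=
  ⟨quotientCompOrbitIso k V⟩

/-- The quotient category is equivalent to the category of modules over a product of copies
of the field indexed by the cyclic vertices. -/
def qgrEquivalence : QGr k V ≌ ModuleCat.{u} (CyclicVertex V → k) :=
  CategoryTheory.Equivalence.mk (qgrOrbitFunctor k V) (cycleFunctor k V ⋙ QGr.quotient k V)
    (Localization.liftNatIso (QGr.quotient k V)
      (GrMod.tors (grade k V) : ObjectProperty (GrPath k V)).isoModSerre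
      (QGr.quotient k V) (orbitFunctor k V ⋙ cycleFunctor k V ⋙ QGr.quotient k V)
      (𝟭 (QGr k V)) (qgrOrbitFunctor k V ⋙ cycleFunctor k V ⋙ QGr.quotient k V)
      (quotientIso k V))
    (Functor.associator _ _ _ ≪≫
      Functor.isoWhiskerLeft (cycleFunctor k V) (quotientCompOrbitIso k V) ≪≫ cycleOrbitIso k V)

end Equivalence

/-! ### The simple modules over a finite power of a field -/

section VertexLine

variable (k : Type u) [Field k] {C : Type u}

/-- The one-dimensional module over `C → k` on which the coordinate `v` acts by scalars. -/
def VertexLine (_ : C) : Type u := k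

instance (v : C) : AddCommGroup (VertexLine k v) := inferInstanceAs (AddCommGroup k)

instance (v : C) : Module (C → k) (VertexLine k v) :=
  Module.compHom k (Pi.evalRingHom (fun _ : C => k) v)

variable {k}

/-- The coordinate of an element of the line. -/
def VertexLine.val {v : C} : VertexLine k v ≃+ k := AddEquiv.refl k

theorem VertexLine.val_smul {v : C} (c : C → k) (x : VertexLine k v) :
    (c • x).val = c v * x.val := rfl

instance (v : C) : IsSimpleModule (C → k) (VertexLine k v) := by
  rw [isSimpleModule_iff_toSpanSingleton_surjective]
  refine ⟨VertexLine.val.toEquiv.nontrivial, fun x hx y => ⟨fun _ => y.val * x.val⁻¹, ?_⟩⟩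
  apply VertexLine.val.injective
  rw [LinearMap.toSpanSingleton_apply, VertexLine.val_smul]
  exact inv_mul_cancel_right₀ (fun h => hx ((map_eq_zero_iff _ VertexLine.val.injective).1 h)) _

/-- The coordinate idempotent at `v` acts as 1 on the line at `v` and as 0 on every other line. -/
theorem VertexLine.eq_of_linearEquiv {v v' : C}
    (e : VertexLine k v ≃ₗ[C → k] VertexLine k v') : v = v' := by
  classical
  by_contra h
  have h1 : (Pi.single v (1 : k) : C → k) • VertexLine.val.symm (1 : k) =
      (VertexLine.val.symm 1 : VertexLine k v) := by
    apply VertexLine.val.injective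
    rw [VertexLine.val_smul, Pi.single_eq_same, one_mul]
  have h2 := congrArg (fun x => (e x).val) h1
  rw [map_smul, VertexLine.val_smul, Pi.single_eq_of_ne (Ne.symm h), zero_mul, eq_comm,
    map_eq_zero_iff _ VertexLine.val.injective, map_eq_zero_iff _ e.injective,
    map_eq_zero_iff _ VertexLine.val.symm.injective] at h2
  exact one_ne_zero h2

/-- A nonzero element is the sum of its coordinate components. A nonzero component at `v` gives a
nonzero map from the line at `v`, and Schur's lemma applies. -/
theorem exists_linearEquiv_vertexLine [Fintype C] (S : Type*) [AddCommGroup S] [Module (C → k) S]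
    [IsSimpleModule (C → k) S] : ∃ v : C, Nonempty (S ≃ₗ[C → k] VertexLine k v) := by
  classical
  have := IsSimpleModule.nontrivial (C → k) S
  obtain ⟨x, hx⟩ := exists_ne (0 : S)
  have hsum : ∑ v : C, (Pi.single v (1 : k) : C → k) • x ≠ 0 := by
    rw [← Finset.sum_smul, show ∑ v : C, (Pi.single v 1 : C → k) = 1 from
      Finset.univ_sum_single (1 : C → k), one_smul]
    exact hx
  obtain ⟨v, _, hv⟩ := Finset.exists_ne_zero_of_sum_ne_zero hsum
  let f : VertexLine k v →ₗ[C → k] S :=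
    { toFun := fun t => (Pi.single v t.val : C → k) • x
      map_add' := fun s t => by rw [← add_smul, map_add, Pi.single_add]
      map_smul' := fun c t => by
        rw [RingHom.id_apply, ← mul_smul, VertexLine.val_smul]
        refine congrArg (· • x) (funext fun w => ?_)
        rw [Pi.mul_apply]
        by_cases h : w = v
        · subst h; rw [Pi.single_eq_same, Pi.single_eq_same]
        · rw [Pi.single_eq_of_ne h, Pi.single_eq_of_ne h, mul_zero] }
  have hf : f ≠ 0 := fun h => hv (congrArg (fun g => g (VertexLine.val.symm 1)) h)
  exact ⟨v, ⟨(LinearEquiv.ofBijective f (LinearMap.bijective_of_ne_zero hf)).symm⟩⟩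

end VertexLine

/-! ### Semisimplicity -/

section Semisimple

theorem isSemisimpleCategory_moduleCat (R : Type u) [Ring R] [IsSemisimpleRing R] :
    IsSemisimpleCategory.{u} (ModuleCat.{u} R) := by
  classical
  intro X
  obtain ⟨s, e, _, hs⟩ := IsSemisimpleModule.exists_linearEquiv_dfinsupp R X
  let Z : s → ModuleCat.{u} R := fun m => ModuleCat.of R m.1
  let e' : ModuleCat.of R (DirectSum s fun m => Z m) ≅ X := LinearEquiv.toModuleIso e.symm
  refine ⟨s, Z, fun m => (ModuleCat.coproductCocone Z).inj m ≫ e'.hom,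
    fun m => simple_iff_isSimpleModule.2 (hs m), ⟨?_⟩⟩
  exact (ModuleCat.coproductCoconeIsColimit Z).ofIsoColimit (Cofan.ext e' fun m => rfl)

theorem IsSemisimpleCategory.of_equivalence {C D : Type*} [Category C] [Category D]
    [HasZeroMorphisms C] [HasZeroMorphisms D] (e : C ≌ D) (h : IsSemisimpleCategory.{u} D) :
    IsSemisimpleCategory.{u} C := by
  intro X
  obtain ⟨ι, S, i, hS, ⟨hc⟩⟩ := h (e.functor.obj X)
  refine ⟨ι, fun j => e.inverse.obj (S j), fun j => e.inverse.map (i j) ≫ (e.unitIso.app X).inv,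
    fun j => ?_, ⟨?_⟩⟩
  · have := hS j
    exact simple_obj e.inverse (S j)
  · exact (isColimitCofanMkObjOfIsColimit e.inverse _ i hc).ofIsoColimit
      (Cofan.ext (e.unitIso.app X).symm fun j => rfl)

end Semisimple

/-! ### The cyclic point modules -/

section PointModule

open Quiver (Path Reachable)
open PathAlgebra

theorem GrMod.isIso_of_bijective {k A : Type*} [Field k] [Ring A] [Algebra k A]
    {𝒜 : ℕ → Submodule k A} {M N : GrMod.{w} 𝒜} (f : M ⟶ N) (hf : Function.Bijective f.lin) :
    IsIso f := by
  have : Mono f := ⟨fun g h hgh => GrMod.hom_ext fun m =>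
    hf.1 (congrArg (fun t => GrMod.Hom.lin t m) hgh)⟩
  have : Epi f := ⟨fun g h hgh => GrMod.hom_ext fun m => by
    obtain ⟨m, rfl⟩ := hf.2 m
    exact congrArg (fun t => GrMod.Hom.lin t m) hgh⟩
  exact isIso_of_mono_of_epi f

theorem OnSimpleCycle.reachable {V : Type u} [Quiver.{u} V] {v a : V} (h : OnSimpleCycle v a) :
    Reachable a v := by
  obtain ⟨p, _, ha⟩ := h
  obtain ⟨_, p₂, _⟩ := p.exists_eq_comp_of_mem_vertices ha
  exact ⟨p₂⟩

variable (k : Type u) [Field k] {V : Type u} [Quiver.{u} V] [Fintype V]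

variable (V) in
/-- The elements of the path algebra as elements of the regular module. -/
def regularElt : PathAlgebra k V ≃+ regularModule k V := AddEquiv.refl (PathAlgebra k V)

variable {k}

theorem op_smul_regularElt (x y : PathAlgebra k V) :
    op x • regularElt k V y = regularElt k V (y * x) := rfl

theorem regularElt_vertexIdem_mul_mem (v : V) (x : PathAlgebra k V) :
    regularElt k V (vertexIdem k v * x) ∈ vertexIdeal k v :=
  Submodule.smul_mem _ (op x) (Submodule.subset_span rfl)

variable (k) in
/-- The class of an element of `e_v kQ` in the cyclic point module. -/
def pointMk (v : V) (x : vertexIdeal k v) : cyclicPointModule k v :=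
  (Submodule.Quotient.mk x :
    vertexIdeal k v ⧸ (leavingIdeal k v).comap (vertexIdeal k v).subtype)

theorem pointMk_surjective (v : V) : Function.Surjective (pointMk k v) :=
  Submodule.Quotient.mk_surjective _

theorem pointMk_eq_zero {v : V} {x : vertexIdeal k v} (hx : x.1 ∈ leavingIdeal k v) :
    pointMk k v x = 0 :=
  (Submodule.Quotient.mk_eq_zero ((leavingIdeal k v).comap (vertexIdeal k v).subtype)).2 hx

variable [IsolatedCycles V]

variable (k) in
/-- The generator of the point module at a cyclic vertex. -/
def pointGen (v : CyclicVertex V) : cycleModule k V (VertexLine k v) :=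
  cycleElt k V _ 0 (VertexLine.val.symm 1)

variable (k) in
/-- The map from the path algebra to the point module that sends `1` to the generator. -/
def pointLin (v : CyclicVertex V) :
    regularModule k V →ₗ[(PathAlgebra k V)ᵐᵒᵖ] cycleModule k V (VertexLine k v) where
  toFun x := op ((regularElt k V).symm x) • pointGen k v
  map_add' x y := by rw [map_add, MulOpposite.op_add, add_smul]
  map_smul' x y := by rw [RingHom.id_apply, ← mul_smul]; rfl

theorem pointLin_regularElt (v : CyclicVertex V) (x : PathAlgebra k V) :
    pointLin k v (regularElt k V x) = op x • pointGen k v := rfl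

theorem pointLin_mem_deg (v : CyclicVertex V) (i : ℤ) (x : regularModule k V)
    (hx : x ∈ (regularModule k V).deg i) :
    pointLin k v x ∈ (cycleModule k V (VertexLine k v)).deg i := by
  refine Submodule.iSup_induction (fun n : {n : ℕ // (n : ℤ) = i} => grade k V n)
    (motive := fun x => op x • pointGen k v ∈ (cycleModule k V (VertexLine k v)).deg i) hx ?_ ?_ ?_
  · rintro ⟨n, rfl⟩ y hy
    have := (cycleModule k V (VertexLine k v)).smul_mem n _ y hy _
      (cycleElt_mem_deg 0 (VertexLine.val.symm 1))
    rwa [Nat.cast_zero, zero_add] at this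
  · rw [MulOpposite.op_zero, zero_smul]
    exact zero_mem _
  · intro x y hx hy
    rw [MulOpposite.op_add, add_smul]
    exact add_mem hx hy

/-- If the end of a path from `v` led back to `v`, it would be a rotate of `v` and so lie on a
simple cycle through it. A leaving path therefore cannot be undone and acts by zero. -/
theorem leavingIdeal_le_ker (v : CyclicVertex V) :
    leavingIdeal k v.1 ≤ LinearMap.ker (pointLin k v) := by
  refine Submodule.span_le.2 ?_
  rintro _ ⟨a, p, ha, rfl⟩
  have hr : ¬ Reachable a v.1 := fun hr => ha (by
    have := onSimpleCycle_cycleRot_pow v p.length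
    rwa [cycleRot_pow_eq v p hr] at this)
  have := smul_ofPath_cycleModule (1 : k) p hr (pointGen k v)
  rw [one_smul] at this
  exact this

variable (k) in
/-- The linear combinations of the paths that start at `v` and follow its cycle. -/
def walkComb (v : CyclicVertex V) : (ℕ →₀ k) →ₗ[k] PathAlgebra k V :=
  Finsupp.linearCombination k fun l => vertexIdem k v.1 * cycleStep k V ^ l

theorem walkComb_single (v : CyclicVertex V) (l : ℕ) (c : k) :
    walkComb k v (Finsupp.single l c) = c • (vertexIdem k v.1 * cycleStep k V ^ l) :=
  Finsupp.linearCombination_single _ _ _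

theorem walkComb_mem_vertexIdeal (v : CyclicVertex V) (f : ℕ →₀ k) :
    regularElt k V (walkComb k v f) ∈ vertexIdeal k v.1 := by
  induction f using Finsupp.induction_linear with
  | zero => rw [map_zero, map_zero]; exact zero_mem _
  | add f g hf hg => rw [map_add, map_add]; exact add_mem hf hg
  | single l c =>
    rw [walkComb_single, ← mul_smul_comm]
    exact regularElt_vertexIdem_mul_mem _ _

/-- The elements of the line at `v` spread along the cycle, as finite sequences of scalars. -/
def lineSeq (v : CyclicVertex V) : (ℕ →₀ k) ≃+ cycleModule k V (VertexLine k v) :=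
  AddEquiv.refl (ℕ →₀ k)

theorem lineSeq_single (v : CyclicVertex V) (l : ℕ) (c : k) :
    lineSeq v (Finsupp.single l c) = cycleElt k V (VertexLine k v) l (VertexLine.val.symm c) := rfl

theorem pointLin_walkComb (v : CyclicVertex V) (f : ℕ →₀ k) :
    pointLin k v (regularElt k V (walkComb k v f)) = lineSeq v f := by
  classical
  induction f using Finsupp.induction_linear with
  | zero => simp only [map_zero]
  | add f g hf hg => rw [map_add, map_add, map_add, map_add, hf, hg]
  | single l c =>
    obtain ⟨p, hp⟩ := exists_path_cycleRot_pow v l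
    rw [walkComb_single, pointLin_regularElt, ← hp,
      ← ofPath_eq_vertexIdem_mul v p (reachable_cycleRot_pow l v), pointGen,
      smul_ofPath_cycleElt c p (reachable_cycleRot_pow l v), zero_add, lineSeq_single]
    refine congrArg (cycleElt k V (VertexLine k v) p.length) (VertexLine.val.injective ?_)
    have h0 : orbitIndicator k 0 v.1 = Pi.single v 1 := orbitIndicator_cycleRot_pow (k := k) 0 v
    rw [VertexLine.val_smul, h0]
    simp

/-- A path from `v` either stays on the cycle, and is then a power of `cycleStep` cut down at `v`,
or it is one of the generators of `leavingIdeal`. -/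
theorem exists_sub_walkComb_mem (v : CyclicVertex V) {x : regularModule k V}
    (hx : x ∈ vertexIdeal k v.1) :
    ∃ f : ℕ →₀ k, x - regularElt k V (walkComb k v f) ∈ leavingIdeal k v.1 := by
  obtain ⟨y, rfl⟩ := Submodule.mem_span_singleton.1 hx
  obtain ⟨y, rfl⟩ := op_surjective y
  clear hx
  change ∃ f : ℕ →₀ k, regularElt k V (vertexIdem k v.1 * y) - regularElt k V (walkComb k v f) ∈
    leavingIdeal k v.1
  induction y using PathAlgebra.induction with
  | zero => exact ⟨0, by rw [mul_zero, map_zero, map_zero, map_zero, sub_zero]; exact zero_mem _⟩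
  | add y z hy hz =>
    obtain ⟨f, hf⟩ := hy
    obtain ⟨g, hg⟩ := hz
    refine ⟨f + g, ?_⟩
    rw [mul_add, map_add, map_add, map_add, add_sub_add_comm]
    exact add_mem hf hg
  | smul c p =>
    obtain ⟨a, b, p⟩ := p
    by_cases ha : v.1 = a
    · subst ha
      rw [mul_smul_comm, vertexIdem_mul_ofPath]
      by_cases hb : Reachable b v.1
      · refine ⟨Finsupp.single p.length c, ?_⟩
        rw [walkComb_single, ← ofPath_eq_vertexIdem_mul v p hb, sub_self]
        exact zero_mem _
      · refine ⟨0, ?_⟩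
        rw [map_zero, map_zero, sub_zero, ← mul_one (ofPath _), ← mul_smul_comm,
          ← op_smul_regularElt]
        exact Submodule.smul_mem _ _
          (Submodule.subset_span ⟨b, p, fun h => hb h.reachable, rfl⟩)
    · refine ⟨0, ?_⟩
      rw [mul_smul_comm, vertexIdem_mul_ofPath_of_ne k p ha, smul_zero, map_zero, map_zero,
        map_zero, sub_zero]
      exact zero_mem _

variable (k) in
/-- The map from the cyclic point module to the line at `v` spread along the cycle. -/
def pointHom (v : CyclicVertex V) :
    cyclicPointModule k v.1 ⟶ cycleModule k V (VertexLine k v) where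
  lin := Submodule.liftQ _ (pointLin k v ∘ₗ (vertexIdeal k v.1).subtype)
    fun x hx => leavingIdeal_le_ker v hx
  map_mem := by
    rintro i _ ⟨x, hx, rfl⟩
    exact pointLin_mem_deg v i x.1 hx

theorem pointHom_pointMk (v : CyclicVertex V) (x : vertexIdeal k v.1) :
    (pointHom k v).lin (pointMk k v.1 x) = pointLin k v x.1 := rfl

/-- `walkComb` provides the inverse. It represents every class of the point module, and `pointLin`
sends it back to its coefficients, so an element of the kernel has zero coefficients. -/
theorem pointHom_bijective (v : CyclicVertex V) : Function.Bijective (pointHom k v).lin := by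
  constructor
  · rw [injective_iff_map_eq_zero]
    intro x hx
    obtain ⟨x, rfl⟩ := pointMk_surjective v.1 x
    rw [pointHom_pointMk] at hx
    obtain ⟨f, hf⟩ := exists_sub_walkComb_mem v x.2
    have h1 : pointLin k v (x.1 - regularElt k V (walkComb k v f)) = 0 :=
      leavingIdeal_le_ker v hf
    rw [map_sub, hx, zero_sub, neg_eq_zero, pointLin_walkComb,
      map_eq_zero_iff _ (lineSeq v).injective] at h1
    rw [h1, map_zero, map_zero, sub_zero] at hf
    exact pointMk_eq_zero hf
  · intro y
    obtain ⟨f, rfl⟩ := (lineSeq v).surjective y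
    exact ⟨pointMk k v.1 ⟨_, walkComb_mem_vertexIdeal v f⟩, pointLin_walkComb v f⟩

variable (k) in
/-- The cyclic point module is the line at `v` spread along the cycle. -/
def pointIso (v : CyclicVertex V) : cyclicPointModule k v.1 ≅ cycleModule k V (VertexLine k v) :=
  have := GrMod.isIso_of_bijective (pointHom k v) (pointHom_bijective v)
  asIso (pointHom k v)

variable [∀ a b : V, Finite (a ⟶ b)]

variable (k) in
/-- The cyclic point module at `v` corresponds to the line at `v`. -/
def equivalencePointIso (v : CyclicVertex V) :
    (qgrEquivalence k V).functor.obj ((QGr.quotient k V).obj (cyclicPointModule k v.1)) ≅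
      ModuleCat.of (CyclicVertex V → k) (VertexLine k v) :=
  (quotientCompOrbitIso k V).app (cyclicPointModule k v.1) ≪≫
    (orbitFunctor k V).mapIso (pointIso k v) ≪≫
      (cycleOrbitIso k V).app (ModuleCat.of (CyclicVertex V → k) (VertexLine k v))

end PointModule

end

/-! ### The structure of the quotient category -/

theorem theorem10p4 (k : Type u) [Field k] (V : Type u) [Quiver.{u} V] [Fintype V]
    [∀ a b : V, Finite (a ⟶ b)] (hGK : GKdim k (PathAlgebra k V) = 1) :
    Nonempty (QGr k V ≌ ModuleCat.{u} (Fin (Nat.card {v : V // IsCyclicVertex v}) → k)) ∧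
    IsSemisimpleCategory.{u} (QGr k V) ∧
    (∀ v : V, IsCyclicVertex v →
      Simple ((QGr.quotient k V).obj (cyclicPointModule k v)) ∧
      Projective ((QGr.quotient k V).obj (cyclicPointModule k v))) ∧
    (∀ X : QGr k V, Simple X →
      ∃! v : {v : V // IsCyclicVertex v},
        Nonempty (X ≅ (QGr.quotient k V).obj (cyclicPointModule k v.1))) := by
  have : IsolatedCycles V := isolatedCycles_of_GKdim hGK.le
  let E := qgrEquivalence k V
  -- The product is indexed by the cyclic vertices themselves; numbering them replaces the index set
  -- by `Fin n`.
  refine ⟨⟨E.trans (ModuleCat.restrictScalarsEquivalenceOfRingEquiv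
      (RingEquiv.piCongrLeft (fun _ : CyclicVertex V => k) (Finite.equivFin _).symm))⟩,
    (isSemisimpleCategory_moduleCat (CyclicVertex V → k)).of_equivalence E, fun v hv => ⟨?_, ?_⟩,
    fun X hX => ?_⟩
  · rw [← simple_obj_iff E.functor, Simple.iff_of_iso (equivalencePointIso k ⟨v, hv⟩),
      simple_iff_isSimpleModule]
    infer_instance
  · rw [← E.map_projective_iff]
    refine Projective.of_iso (equivalencePointIso k ⟨v, hv⟩).symm ?_
    rw [← IsProjective.iff_projective]
    exact Module.projective_of_isSemisimpleRing _ _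
  · have := simple_obj E.functor X
    have : IsSimpleModule (CyclicVertex V → k) (E.functor.obj X) :=
      (simple_iff_isSimpleModule' _).1 this
    obtain ⟨v, ⟨e⟩⟩ := exists_linearEquiv_vertexLine (k := k) (C := CyclicVertex V)
      (E.functor.obj X)
    let e' : E.functor.obj X ≅ ModuleCat.of (CyclicVertex V → k) (VertexLine k v) :=
      e.toModuleIso
    refine ⟨v, ⟨E.functor.preimageIso (e' ≪≫ (equivalencePointIso k v).symm)⟩, ?_⟩
    -- Uniqueness: both point modules correspond to the same simple module, so their lines are
    -- isomorphic.
    rintro v' ⟨i⟩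
    have i' := e'.symm ≪≫ E.functor.mapIso i ≪≫ equivalencePointIso k v'
    exact (VertexLine.eq_of_linearEquiv i'.toLinearEquiv).symm
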